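/- **Theorem.** For $n\ge 0$ let $S_n$ be the set of permutations $\pi=\pi_1\cdots\pi_n$ of $\{1,\dots,n\}$, and let $\operatorname{Av}_n(231,1243)$ be the set of those $\pi\in S_n$ that contain no subsequence in the same relative order as $231$ or as $1243$. A *hook* of $\pi$ with southwest endpoint $(i,\pi_i)$ and northeast endpoint $(j,\pi_j)$, where $i<j$ and $\pi_i<\pi_j$, is the union of the vertical segment from $(i,\pi_i)$ to $(i,\pi_j)$ and the horizontal segment from $(i,\pi_j)$ to $(j,\pi_j)$. Let $d_1<\dots<d_k$ be the descents of $\pi$, that is, the indices $d\in\{1,\dots,n-1\}$ with $\pi_d>\pi_{d+1}$. A *valid hook configuration* of $\pi$ is a tuple $(H_1,\dots,H_k)$ of hooks of $\pi$ such that 1. for every $i\in\{1,\dots,k\}$, the southwest endpoint of $H_i$ is $(d_i,\pi_{d_i})$; 2. no point $(l,\pi_l)$ lies directly above a hook; 3. two distinct hooks of the tuple do not meet, except that the northeast endpoint of one may be the southwest endpoint of the other. (A permutation without descents, including the empty one, has exactly one valid hook configuration, the empty tuple.) Let $\operatorname{VHC}(\operatorname{Av}_n(231,1243))$ be the set of all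 pairs of a permutation $\pi\in\operatorname{Av}_n(231,1243)$ and a valid hook configuration of $\pi$. Then $$\sum_{n\ge 0}\bigl|\operatorname{VHC}(\operatorname{Av}_n(231,1243))\bigr|\,x^n \;=\; 1+\frac{2x^2}{3x-1+\sqrt{1-2x-3x^2}},$$ where $\sqrt{1-2x-3x^2}$ is the formal power series over $\mathbb{Q}$ with constant term $1$ whose square is $1-2x-3x^2$, the series $3x-1+\sqrt{1-2x-3x^2}$ is nonzero, and the quotient is taken in the field of formal Laurent series. -/

import Mathlib

namespace HookConfig

/-- Permutations of `{1, …, n}` are modelled as permutations of `Fin n` (positions and values are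
shifted by one); `π i` is the entry in position `i`. The permutation `σ` contains the pattern `τ`
if some subsequence of `σ` is in the same relative order as `τ`. -/
def Contains {m n : ℕ} (σ : Equiv.Perm (Fin n)) (τ : Equiv.Perm (Fin m)) : Prop :=
  ∃ f : Fin m ↪o Fin n, ∀ a b : Fin m, σ (f a) < σ (f b) ↔ τ a < τ b

/-- The set of permutations of length `n` that avoid all the patterns in `P`. -/
def Av (n : ℕ) (P : Set (Σ m : ℕ, Equiv.Perm (Fin m))) : Set (Equiv.Perm (Fin n)) :=
  {σ | ∀ τ ∈ P, ¬ Contains σ τ.2}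

/-- The pattern `231`. -/
def p231 : Equiv.Perm (Fin 3) where
  toFun := ![1, 2, 0]
  invFun := ![2, 0, 1]
  left_inv := by decide
  right_inv := by decide

/-- The pattern `1243`. -/
def p1243 : Equiv.Perm (Fin 4) where
  toFun := ![0, 1, 3, 2]
  invFun := ![0, 1, 3, 2]
  left_inv := by decide
  right_inv := by decide

/-- `i` is a descent of `π` if position `i` has a successor and the entry there is smaller. -/
def IsDescent {n : ℕ} (π : Equiv.Perm (Fin n)) (i : Fin n) : Prop :=
  ∃ h : (i : ℕ) + 1 < n, π ⟨i + 1, h⟩ < π i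

/-- The point of the plot of `π` in column `i`. -/
def plotPoint {n : ℕ} (π : Equiv.Perm (Fin n)) (i : Fin n) : ℝ × ℝ :=
  (((i : ℕ) : ℝ), ((π i : ℕ) : ℝ))

/-- A hook of `π`, given by the columns of its southwest and northeast endpoints. -/
@[ext]
structure Hook {n : ℕ} (π : Equiv.Perm (Fin n)) where
  sw : Fin n
  ne : Fin n
  sw_lt_ne : sw < ne
  height_lt : π sw < π ne

/-- The hook as a subset of the plane: a vertical segment going up from the southwest endpoint,
followed by a horizontal segment going right to the northeast endpoint. -/
def Hook.points {n : ℕ} {π : Equiv.Perm (Fin n)} (H : Hook π) : Set (ℝ × ℝ) :=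
  {p | p.1 = (plotPoint π H.sw).1 ∧ (plotPoint π H.sw).2 ≤ p.2 ∧ p.2 ≤ (plotPoint π H.ne).2} ∪
  {p | p.2 = (plotPoint π H.ne).2 ∧ (plotPoint π H.sw).1 ≤ p.1 ∧ p.1 ≤ (plotPoint π H.ne).1}

/-- A valid hook configuration of `π`: the tuple of hooks is indexed by the descents of `π`. -/
@[ext]
structure VHC {n : ℕ} (π : Equiv.Perm (Fin n)) where
  hook : {d : Fin n // IsDescent π d} → Hook π
  /-- The southwest endpoint of each hook is the corresponding descent top. -/
  sw_hook : ∀ d, (hook d).sw = d.1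
  /-- No point of the plot lies directly above a hook. -/
  not_above : ∀ d, ∀ l : Fin n, ∀ q ∈ (hook d).points,
    ¬ (q.1 = (plotPoint π l).1 ∧ q.2 < (plotPoint π l).2)
  /-- Distinct hooks meet only where the northeast endpoint of one is the southwest endpoint of
  the other. -/
  inter : ∀ d e, d ≠ e → ∀ q ∈ (hook d).points ∩ (hook e).points,
    (q = plotPoint π (hook d).ne ∧ q = plotPoint π (hook e).sw) ∨
    (q = plotPoint π (hook d).sw ∧ q = plotPoint π (hook e).ne)

instance finite_hook {n : ℕ} (π : Equiv.Perm (Fin n)) : Finite (Hook π) :=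
  Finite.of_injective (fun H : Hook π => (H.sw, H.ne)) fun _ _ h =>
    Hook.ext (congrArg Prod.fst h) (congrArg Prod.snd h)

instance finite_vhc {n : ℕ} (π : Equiv.Perm (Fin n)) : Finite (VHC π) :=
  Finite.of_injective VHC.hook fun _ _ h => VHC.ext h

/-- The set of valid hook configurations (together with their underlying permutations) of the
permutations in `A`. It is finite, since the ambient type is. -/
def VHCs {n : ℕ} (A : Set (Equiv.Perm (Fin n))) : Set (Σ π : Equiv.Perm (Fin n), VHC π) :=
  {H | H.1 ∈ A}

end HookConfig

/-! The count is refined by allowing unfinished configurations: some descents may still be open,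
that is, without a hook, provided that no chosen hook shelters an open descent. Counting these by
length and number `s` of open descents gives a linear system, obtained by locating the largest
entry.

If it is last, either no hook ends there, or exactly one does. In the second case that hook is
removed, which opens one more descent; conversely it can only be restored at the rightmost open
descent (`encard_last`). If it is first, it is deleted together with the open descent it causes
(`setOf_first`). If it is interior, the two patterns force the entries before it to decrease, and
deleting the first entry leads either to another interior case or to permutations that also avoid
132 (`encard_middleConfigs`). Those have their largest entry first or last, so their recursion
closes.

In generating functions, with `t = x(1 + t + t²)`, the 132-avoiding series for `s` is `(1 + t +
t²)tˢ`. This gives the interior series, and then the full system yields `1/(1 - t)` for `s = 0`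
(`configSeries_zero_mul`), where length `n + 1` is weighted by `xⁿ`. Hence the sought series is `1 +
x/(1 - t)`. Since `√(1 - 2x - 3x²) = 1 - x - 2xt`, the denominator in the theorem equals `2x(1 -
t)`.

Plane hooks enter only at the end: the geometric conditions amount to a height bound and a nesting
condition on columns (`Hook.not_above_iff`, `Hook.inter_iff`). -/

namespace HookConfig

/-! ### Partial configurations and insertion of a first entry. -/

/-- A permutation of `{0, …, n - 1}`, extended by the identity to all of `ℕ`, that avoids `231` and
`1243`, together with a partial choice of hooks at its descents: `p.2 d` is the column of the
northeast endpoint of the hook at `d`, or `0` if no hook is chosen at `d`. A chosen hook only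
shelters descents whose hooks are chosen. -/
structure IsPartialConfig (n : ℕ) (p : (ℕ → ℕ) × (ℕ → ℕ)) : Prop where
  inj : Function.Injective p.1
  fix : ∀ i, n ≤ i → p.1 i = i
  avoid231 : ∀ i j k, i < j → j < k → ¬ (p.1 k < p.1 i ∧ p.1 i < p.1 j)
  avoid1243 : ∀ i j k l, i < j → j < k → k < l →
    ¬ (p.1 i < p.1 j ∧ p.1 j < p.1 l ∧ p.1 l < p.1 k)
  descent : ∀ d, p.2 d ≠ 0 → p.1 (d + 1) < p.1 d
  lt_hook : ∀ d, p.2 d ≠ 0 → d < p.2 d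
  hook_lt : ∀ d, p.2 d ≠ 0 → p.2 d < n
  below : ∀ d, p.2 d ≠ 0 → ∀ l, d ≤ l → l < p.2 d → p.1 l < p.1 (p.2 d)
  nested : ∀ d e, d < e → e < p.2 d → p.1 (e + 1) < p.1 e → p.2 e ≠ 0 ∧ p.2 e < p.2 d

/-- The number of descents without a chosen hook. -/
def openCount (n : ℕ) (p : (ℕ → ℕ) × (ℕ → ℕ)) : ℕ :=
  ∑ d ∈ Finset.range n, if p.1 (d + 1) < p.1 d ∧ p.2 d = 0 then 1 else 0

/-- Put a new first entry of value `v` in front, with hook `c`. -/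
def prepend (v c : ℕ) (p : (ℕ → ℕ) × (ℕ → ℕ)) : (ℕ → ℕ) × (ℕ → ℕ) :=
  (fun i => Nat.casesOn i v fun i => if p.1 i < v then p.1 i else p.1 i + 1,
   fun i => Nat.casesOn i c fun i => if p.2 i = 0 then 0 else p.2 i + 1)

/-- Delete the first entry. -/
def deleteFirst (p : (ℕ → ℕ) × (ℕ → ℕ)) : (ℕ → ℕ) × (ℕ → ℕ) :=
  (fun i => if p.1 (i + 1) < p.1 0 then p.1 (i + 1) else p.1 (i + 1) - 1, fun i => p.2 (i + 1) - 1)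

section prepend

variable (v c : ℕ) (p : (ℕ → ℕ) × (ℕ → ℕ))

@[simp] lemma prepend_fst_zero : (prepend v c p).1 0 = v := rfl

@[simp] lemma prepend_fst_succ (i : ℕ) :
    (prepend v c p).1 (i + 1) = if p.1 i < v then p.1 i else p.1 i + 1 := rfl

@[simp] lemma prepend_snd_zero : (prepend v c p).2 0 = c := rfl

@[simp] lemma prepend_snd_succ (i : ℕ) :
    (prepend v c p).2 (i + 1) = if p.2 i = 0 then 0 else p.2 i + 1 := rfl

lemma prepend_fst_succ_lt_succ (i j : ℕ) :
    (prepend v c p).1 (i + 1) < (prepend v c p).1 (j + 1) ↔ p.1 i < p.1 j := by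
  simp only [prepend_fst_succ]; split_ifs <;> omega

lemma prepend_fst_succ_lt (i : ℕ) : (prepend v c p).1 (i + 1) < v ↔ p.1 i < v := by
  simp only [prepend_fst_succ]; split_ifs <;> omega

lemma lt_prepend_fst_succ (i : ℕ) : v < (prepend v c p).1 (i + 1) ↔ v ≤ p.1 i := by
  simp only [prepend_fst_succ]; split_ifs <;> omega

lemma prepend_snd_succ_ne_zero (i : ℕ) : (prepend v c p).2 (i + 1) ≠ 0 ↔ p.2 i ≠ 0 := by
  simp only [prepend_snd_succ]; split_ifs <;> omega

lemma prepend_snd_succ_of_ne_zero {i : ℕ} (h : p.2 i ≠ 0) :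
    (prepend v c p).2 (i + 1) = p.2 i + 1 := by
  simp [h]

lemma deleteFirst_prepend : deleteFirst (prepend v c p) = p := by
  ext i
  · simp only [deleteFirst, prepend_fst_succ, prepend_fst_zero]; split_ifs <;> omega
  · simp only [deleteFirst, prepend_snd_succ]; split_ifs <;> omega

lemma prepend_injective (f g : (ℕ → ℕ) × (ℕ → ℕ) → ℕ) :
    Function.Injective fun p => prepend (f p) (g p) p := fun p q h => by
  simpa only [deleteFirst_prepend] using congrArg deleteFirst h

lemma openCount_prepend (n : ℕ) :
    openCount (n + 1) (prepend v c p) = openCount n p + if p.1 0 < v ∧ c = 0 then 1 else 0 := by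
  have h (d : ℕ) : (prepend v c p).2 (d + 1) = 0 ↔ p.2 d = 0 :=
    not_iff_not.1 (prepend_snd_succ_ne_zero v c p d)
  have h0 := prepend_fst_succ_lt v c p 0
  unfold openCount
  rw [Finset.sum_range_succ']
  simp only [prepend_fst_succ_lt_succ, h, prepend_snd_zero, prepend_fst_zero, zero_add] at h0 ⊢
  simp only [h0]

end prepend

lemma IsPartialConfig.lt {n : ℕ} {p : (ℕ → ℕ) × (ℕ → ℕ)} (hp : IsPartialConfig n p) {i : ℕ}
    (hi : i < n) : p.1 i < n := by
  by_contra h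
  have := hp.inj (hp.fix _ (not_lt.1 h))
  omega

lemma IsPartialConfig.surj {n : ℕ} {p : (ℕ → ℕ) × (ℕ → ℕ)} (hp : IsPartialConfig n p) :
    Function.Surjective p.1 := by
  intro y
  by_cases hy : y < n
  · have hsub : (Finset.range n).image p.1 ⊆ Finset.range n := by
      intro z hz
      simp only [Finset.mem_image, Finset.mem_range] at hz ⊢
      obtain ⟨i, hi, rfl⟩ := hz
      exact hp.lt hi
    have heq := Finset.eq_of_subset_of_card_le hsub
      (by rw [Finset.card_image_of_injective _ hp.inj])
    have : y ∈ (Finset.range n).image p.1 := by rw [heq]; simpa using hy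
    obtain ⟨i, -, hi⟩ := Finset.mem_image.1 this
    exact ⟨i, hi⟩
  · exact ⟨y, hp.fix y (not_lt.1 hy)⟩

lemma prepend_deleteFirst {n : ℕ} {p : (ℕ → ℕ) × (ℕ → ℕ)} (hp : IsPartialConfig n p) :
    prepend (p.1 0) (p.2 0) (deleteFirst p) = p := by
  ext i
  · cases i with
    | zero => rfl
    | succ i =>
      have h : p.1 (i + 1) ≠ p.1 0 := fun h => by simpa using hp.inj h
      simp only [prepend_fst_succ, deleteFirst]
      split_ifs <;> omega
  · cases i with
    | zero => rfl
    | succ i =>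
      have := hp.lt_hook (i + 1)
      simp only [prepend_snd_succ, deleteFirst]
      split_ifs <;> omega

/-- The conditions for prepending an entry to give a partial configuration. -/
structure CanPrepend (n v c : ℕ) (p : (ℕ → ℕ) × (ℕ → ℕ)) : Prop where
  le : v ≤ n
  avoid231 : ∀ j k, j < k → ¬ (p.1 k < v ∧ v ≤ p.1 j)
  avoid1243 : ∀ j k l, j < k → k < l → ¬ (v ≤ p.1 j ∧ p.1 j < p.1 l ∧ p.1 l < p.1 k)
  descent : c ≠ 0 → p.1 0 < v
  hook_le : c ≠ 0 → c ≤ n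
  le_hook : c ≠ 0 → v ≤ p.1 (c - 1)
  below : ∀ l, l + 1 < c → p.1 l < p.1 (c - 1)
  nested : ∀ e, e + 1 < c → p.1 (e + 1) < p.1 e → p.2 e ≠ 0 ∧ p.2 e + 1 < c

/-- Insertion preserves the order of the old entries, so conditions not involving the new column are
those of `p`. The instances with leftmost column 0 make up `CanPrepend`. -/
lemma isPartialConfig_prepend_iff {n v c : ℕ} {p : (ℕ → ℕ) × (ℕ → ℕ)} :
    IsPartialConfig (n + 1) (prepend v c p) ↔ IsPartialConfig n p ∧ CanPrepend n v c p := by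
  have hlt := prepend_fst_succ_lt_succ v c p
  have hlv := prepend_fst_succ_lt v c p
  have hvl := lt_prepend_fst_succ v c p
  have hne := prepend_snd_succ_ne_zero v c p
  have hs := fun i => @prepend_snd_succ_of_ne_zero v c p i
  have hz : (prepend v c p).1 0 = v := rfl
  have hc : (prepend v c p).2 0 = c := rfl
  constructor
  · intro h
    have hv : v ≤ n := Nat.lt_succ_iff.1 (h.lt (Nat.succ_pos n))
    refine ⟨⟨?_, ?_, ?_, ?_, ?_, ?_, ?_, ?_, ?_⟩, ⟨hv, ?_, ?_, ?_, ?_, ?_, ?_, ?_⟩⟩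
    · intro i j hij
      have := @h.inj (i + 1) (j + 1) (by simp [hij])
      omega
    · intro i hi
      have := h.fix (i + 1) (by omega)
      rw [prepend_fst_succ] at this
      split_ifs at this <;> omega
    · intro i j k hij hjk
      have := h.avoid231 (i + 1) (j + 1) (k + 1) (by omega) (by omega)
      rwa [hlt, hlt] at this
    · intro i j k l hij hjk hkl
      have := h.avoid1243 (i + 1) (j + 1) (k + 1) (l + 1) (by omega) (by omega) (by omega)
      rwa [hlt, hlt, hlt] at this
    · intro d hd
      exact (hlt _ _).1 (h.descent (d + 1) ((hne d).2 hd))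
    · intro d hd
      have := h.lt_hook (d + 1) ((hne d).2 hd)
      rw [hs d hd] at this; omega
    · intro d hd
      have := h.hook_lt (d + 1) ((hne d).2 hd)
      rw [hs d hd] at this; omega
    · intro d hd l hdl hl
      have := h.below (d + 1) ((hne d).2 hd) (l + 1) (by omega) (by rw [hs d hd]; omega)
      rwa [hs d hd, hlt] at this
    · intro d e hde he hdes
      have hd : p.2 d ≠ 0 := by omega
      have := h.nested (d + 1) (e + 1) (by omega) (by rw [hs d hd]; omega) ((hlt _ _).2 hdes)
      have he' := (hne e).1 this.1
      rw [hs d hd, hs e he'] at this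
      exact ⟨he', by omega⟩
    · intro j k hjk
      have := h.avoid231 0 (j + 1) (k + 1) (by omega) (by omega)
      rwa [hz, hlv, hvl] at this
    · intro j k l hjk hkl
      have := h.avoid1243 0 (j + 1) (k + 1) (l + 1) (by omega) (by omega) (by omega)
      rwa [hz, hvl, hlt, hlt] at this
    · intro hc0
      exact (hlv 0).1 (h.descent 0 hc0)
    · intro hc0
      have := h.hook_lt 0 hc0
      omega
    · intro hc0
      have := h.below 0 hc0 0 le_rfl (by omega)
      obtain ⟨c', rfl⟩ : ∃ c', c = c' + 1 := ⟨c - 1, by omega⟩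
      exact (hvl c').1 this
    · intro l hl
      have := h.below 0 (by omega) (l + 1) (by omega) (by omega)
      obtain ⟨c', rfl⟩ : ∃ c', c = c' + 1 := ⟨c - 1, by omega⟩
      exact (hlt l c').1 this
    · intro e he hdes
      have := h.nested 0 (e + 1) (by omega) (by omega) ((hlt _ _).2 hdes)
      have he' := (hne e).1 this.1
      rw [hs e he', hc] at this
      exact ⟨he', this.2⟩
  · rintro ⟨h, g⟩
    refine ⟨?_, ?_, ?_, ?_, ?_, ?_, ?_, ?_, ?_⟩
    · rintro (_ | i) (_ | j) hij
      · rfl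
      · simp only [prepend_fst_zero, prepend_fst_succ] at hij
        split_ifs at hij <;> omega
      · simp only [prepend_fst_zero, prepend_fst_succ] at hij
        split_ifs at hij <;> omega
      · have := @h.inj i j
        simp only [prepend_fst_succ] at hij
        split_ifs at hij <;> simp <;> apply this <;> omega
    · rintro (_ | i) hi
      · omega
      · have := h.fix i (by omega)
        have := g.le
        rw [prepend_fst_succ]
        split_ifs <;> omega
    · rintro (_ | i) j k hij hjk
      · obtain ⟨j, rfl⟩ : ∃ c', j = c' + 1 := ⟨j - 1, by omega⟩
        obtain ⟨k, rfl⟩ : ∃ c', k = c' + 1 := ⟨k - 1, by omega⟩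
        rw [hz, hlv, hvl]
        exact g.avoid231 j k (by omega)
      · obtain ⟨j, rfl⟩ : ∃ c', j = c' + 1 := ⟨j - 1, by omega⟩
        obtain ⟨k, rfl⟩ : ∃ c', k = c' + 1 := ⟨k - 1, by omega⟩
        rw [hlt, hlt]
        exact h.avoid231 i j k (by omega) (by omega)
    · rintro (_ | i) j k l hij hjk hkl
      · obtain ⟨j, rfl⟩ : ∃ c', j = c' + 1 := ⟨j - 1, by omega⟩
        obtain ⟨k, rfl⟩ : ∃ c', k = c' + 1 := ⟨k - 1, by omega⟩
        obtain ⟨l, rfl⟩ : ∃ c', l = c' + 1 := ⟨l - 1, by omega⟩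
        rw [hz, hvl, hlt, hlt]
        exact g.avoid1243 j k l (by omega) (by omega)
      · obtain ⟨j, rfl⟩ : ∃ c', j = c' + 1 := ⟨j - 1, by omega⟩
        obtain ⟨k, rfl⟩ : ∃ c', k = c' + 1 := ⟨k - 1, by omega⟩
        obtain ⟨l, rfl⟩ : ∃ c', l = c' + 1 := ⟨l - 1, by omega⟩
        rw [hlt, hlt, hlt]
        exact h.avoid1243 i j k l (by omega) (by omega) (by omega)
    · rintro (_ | d) hd
      · exact (hlv 0).2 (g.descent hd)
      · exact (hlt _ _).2 (h.descent d ((hne d).1 hd))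
    · rintro (_ | d) hd
      · exact Nat.pos_of_ne_zero hd
      · have hd' := (hne d).1 hd
        have := h.lt_hook d hd'
        rw [hs d hd']; omega
    · rintro (_ | d) hd
      · exact Nat.lt_succ_iff.2 (g.hook_le hd)
      · have hd' := (hne d).1 hd
        have := h.hook_lt d hd'
        rw [hs d hd']; omega
    · rintro (_ | d) hd l hdl hl
      · rw [hc] at hd hl ⊢
        obtain ⟨c', rfl⟩ : ∃ c', c = c' + 1 := ⟨c - 1, by omega⟩
        rcases l with _ | l
        · exact (hvl c').2 (g.le_hook hd)
        · exact (hlt l c').2 (g.below l hl)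
      · have hd' := (hne d).1 hd
        obtain ⟨l, rfl⟩ : ∃ c', l = c' + 1 := ⟨l - 1, by omega⟩
        rw [hs d hd'] at hl ⊢
        exact (hlt _ _).2 (h.below d hd' l (by omega) (by omega))
    · rintro (_ | d) e hde he hdes
      · obtain ⟨e, rfl⟩ : ∃ c', e = c' + 1 := ⟨e - 1, by omega⟩
        have := g.nested e he ((hlt _ _).1 hdes)
        refine ⟨(hne e).2 this.1, ?_⟩
        rw [hs e this.1, hc]
        exact this.2
      · obtain ⟨e, rfl⟩ : ∃ c', e = c' + 1 := ⟨e - 1, by omega⟩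
        have hd' := (hne d).1 (by omega)
        rw [hs d hd'] at he ⊢
        have := h.nested d e (by omega) (by omega) ((hlt _ _).1 hdes)
        refine ⟨(hne e).2 this.1, ?_⟩
        rw [hs e this.1]
        omega

end HookConfig

/-! ### Largest entry in last or first position. -/

namespace HookConfig

/-- The sequence `σ` avoids the pattern `132`. -/
def Avoids132 (σ : ℕ → ℕ) : Prop :=
  ∀ i j k, i < j → j < k → ¬ (σ i < σ k ∧ σ k < σ j)

/-- Partial configurations of length `n` with `s` open descents, avoiding moreover `132` if `Q`
holds. -/
def configs (Q : Prop) (n s : ℕ) : Set ((ℕ → ℕ) × (ℕ → ℕ)) :=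
  {p | IsPartialConfig n p ∧ openCount n p = s ∧ (Q → Avoids132 p.1)}

/-- Partial configurations whose largest entry is neither first nor last. -/
def middleConfigs (n s : ℕ) : Set ((ℕ → ℕ) × (ℕ → ℕ)) :=
  {p ∈ configs False (n + 1) s | p.1 0 ≠ n ∧ p.1 n ≠ n}

lemma avoids132_prepend {v c : ℕ} {p : (ℕ → ℕ) × (ℕ → ℕ)} :
    Avoids132 (prepend v c p).1 ↔
      Avoids132 p.1 ∧ ∀ j k, j < k → ¬ (v ≤ p.1 k ∧ p.1 k < p.1 j) := by
  constructor
  · refine fun h => ⟨fun i j k hij hjk => ?_, fun j k hjk => ?_⟩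
    · have := h (i + 1) (j + 1) (k + 1) (by omega) (by omega)
      rwa [prepend_fst_succ_lt_succ, prepend_fst_succ_lt_succ] at this
    · have := h 0 (j + 1) (k + 1) (by omega) (by omega)
      rwa [prepend_fst_zero, lt_prepend_fst_succ, prepend_fst_succ_lt_succ] at this
  · rintro ⟨h, g⟩ (_ | i) j k hij hjk
    · obtain ⟨j, rfl⟩ : ∃ c', j = c' + 1 := ⟨j - 1, by omega⟩
      obtain ⟨k, rfl⟩ : ∃ c', k = c' + 1 := ⟨k - 1, by omega⟩
      rw [prepend_fst_zero, lt_prepend_fst_succ, prepend_fst_succ_lt_succ]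
      exact g j k (by omega)
    · obtain ⟨j, rfl⟩ : ∃ c', j = c' + 1 := ⟨j - 1, by omega⟩
      obtain ⟨k, rfl⟩ : ∃ c', k = c' + 1 := ⟨k - 1, by omega⟩
      rw [prepend_fst_succ_lt_succ, prepend_fst_succ_lt_succ]
      exact h i j k (by omega) (by omega)

lemma IsPartialConfig.le_of_le {n : ℕ} {p : (ℕ → ℕ) × (ℕ → ℕ)} (hp : IsPartialConfig n p)
    {k : ℕ} (hk : n ≤ p.1 k) : n ≤ k := by
  by_contra hk'
  have := hp.lt (not_le.1 hk')
  omega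

lemma IsPartialConfig.not_lt_of_le {n : ℕ} {p : (ℕ → ℕ) × (ℕ → ℕ)} (hp : IsPartialConfig n p)
    {j k : ℕ} (hjk : j < k) (hk : n ≤ p.1 k) : ¬ p.1 k < p.1 j := by
  intro h
  have := hp.fix k (hp.le_of_le hk)
  by_cases hj : j < n
  · have := hp.lt hj
    omega
  · have := hp.fix j (by omega)
    omega

lemma openCount_succ_of_last {n : ℕ} {p : (ℕ → ℕ) × (ℕ → ℕ)} (hn : p.1 n = n)
    (hn' : p.1 (n + 1) = n + 1) : openCount (n + 1) p = openCount n p := by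
  rw [openCount, Finset.sum_range_succ, if_neg (by omega), add_zero, openCount]

/-- The bound `1 ≤ n` matters because the value 0 encodes a missing hook, so "no hook ends in column
`n`" would be misread at `n = 0`. -/
lemma setOf_last_not_hooked (Q : Prop) {n : ℕ} (hn : 1 ≤ n) (s : ℕ) :
    {p ∈ configs Q (n + 1) s | p.1 n = n ∧ ∀ d, p.2 d ≠ n} = configs Q n s := by
  ext p
  constructor
  · rintro ⟨⟨hp, hs, hQ⟩, hpn, hd⟩
    refine ⟨⟨hp.inj, fun i hi => ?_, hp.avoid231, hp.avoid1243, hp.descent, hp.lt_hook,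
      fun d h0 => ?_, hp.below, hp.nested⟩, ?_, hQ⟩
    · rcases hi.eq_or_lt with rfl | hi
      · exact hpn
      · exact hp.fix i hi
    · have := hp.hook_lt d h0
      have := hd d
      omega
    · rwa [← openCount_succ_of_last hpn (hp.fix _ le_rfl)]
  · rintro ⟨hp, hs, hQ⟩
    refine ⟨⟨⟨hp.inj, fun i hi => hp.fix i (by omega), hp.avoid231, hp.avoid1243, hp.descent,
      hp.lt_hook, fun d h0 => (hp.hook_lt d h0).trans (Nat.lt_succ_self n), hp.below, hp.nested⟩,
      ?_, hQ⟩, hp.fix n le_rfl, fun d => ?_⟩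
    · rwa [openCount_succ_of_last (hp.fix n le_rfl) (hp.fix _ (Nat.le_succ n))]
    · have := hp.hook_lt d
      omega

/-- Remove the hook that ends in column `n`. -/
def unhook (n : ℕ) (p : (ℕ → ℕ) × (ℕ → ℕ)) : (ℕ → ℕ) × (ℕ → ℕ) :=
  (p.1, fun d => if p.2 d = n then 0 else p.2 d)

/-- If two hooks ended together, the left one would shelter the start of the right one and nesting
would make the right one end strictly earlier. -/
lemma IsPartialConfig.eq_of_hook_eq {n : ℕ} {p : (ℕ → ℕ) × (ℕ → ℕ)} (hp : IsPartialConfig n p)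
    {d e : ℕ} (h0 : p.2 d ≠ 0) (h : p.2 d = p.2 e) : d = e := by
  rcases lt_trichotomy d e with hde | hde | hde
  · have := hp.lt_hook e (by omega)
    have := hp.nested d e hde (by omega) (hp.descent e (by omega))
    omega
  · exact hde
  · have := hp.lt_hook d (by omega)
    have := hp.nested e d hde (by omega) (hp.descent d (by omega))
    omega

lemma openCount_unhook {n : ℕ} {p : (ℕ → ℕ) × (ℕ → ℕ)}
    (hp : IsPartialConfig (n + 1) p) {d : ℕ} (hd : p.2 d = n) (hn : n ≠ 0) :
    openCount n (unhook n p) = openCount n p + 1 := by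
  have hdn := hp.lt_hook d (by omega)
  have h1 : ∑ e ∈ Finset.range n, (if e = d then 1 else 0) = 1 := by
    rw [Finset.sum_ite_eq' (Finset.range n) d]
    simp; omega
  rw [openCount, openCount]
  refine Eq.trans ?_ (congrArg (_ + ·) h1)
  rw [← Finset.sum_add_distrib]
  refine Finset.sum_congr rfl fun e _ => ?_
  have := hp.descent d (by omega)
  simp only [unhook]
  by_cases he : e = d
  · subst he
    simp [hd, this, hn]
  · have hne : p.2 e ≠ n := fun h => he (hp.eq_of_hook_eq (by omega) (h.trans hd.symm))
    simp [he, hne]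

lemma exists_last_open {n : ℕ} {p : (ℕ → ℕ) × (ℕ → ℕ)} (hs : openCount n p ≠ 0) :
    ∃ d < n, p.1 (d + 1) < p.1 d ∧ p.2 d = 0 ∧
      ∀ e < n, d < e → p.1 (e + 1) < p.1 e → p.2 e ≠ 0 := by
  set F := (Finset.range n).filter fun d => p.1 (d + 1) < p.1 d ∧ p.2 d = 0 with hF
  have hne : F.Nonempty := by
    rw [← Finset.card_ne_zero, hF, Finset.card_filter]
    exact hs
  have hm := F.max'_mem hne
  have hmem (d : ℕ) (hd : d ∈ F) : d < n ∧ p.1 (d + 1) < p.1 d ∧ p.2 d = 0 := by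
    simpa [hF] using hd
  replace hm := hmem _ hm
  refine ⟨F.max' hne, hm.1, hm.2.1, hm.2.2, fun e he hde hdes h0 => ?_⟩
  have := F.le_max' e (Finset.mem_filter.2 ⟨Finset.mem_range.2 he, hdes, h0⟩)
  omega

/-- The start of the removed hook is recoverable: every descent to its right was sheltered, hence
hooked, so after removal it is the rightmost open descent. -/
lemma bijOn_unhook (Q : Prop) {n : ℕ} (hn : 1 ≤ n) (s : ℕ) :
    Set.BijOn (unhook n) {p ∈ configs Q (n + 1) s | p.1 n = n ∧ ∃ d, p.2 d = n}
      (configs Q n (s + 1)) := by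
  refine ⟨?_, ?_, ?_⟩
  · rintro p ⟨⟨hp, hs, hQ⟩, hpn, d, hd⟩
    have key : ∀ e, (unhook n p).2 e ≠ 0 → p.2 e ≠ 0 ∧ p.2 e ≠ n ∧ (unhook n p).2 e = p.2 e := by
      intro e he
      simp only [unhook] at he ⊢
      split_ifs at he ⊢ <;> simp_all
    refine ⟨⟨hp.inj, fun i hi => ?_, hp.avoid231, hp.avoid1243,
      fun e he => hp.descent e (key e he).1, fun e he => ?_, fun e he => ?_, fun e he => ?_,
      fun e f hef hf hdes => ?_⟩, ?_, hQ⟩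
    · rcases hi.eq_or_lt with rfl | hi
      · exact hpn
      · exact hp.fix i hi
    · have := key e he
      have := hp.lt_hook e
      omega
    · have := key e he
      have := hp.hook_lt e
      omega
    · have := key e he
      rw [this.2.2]
      exact hp.below e this.1
    · have h1 := key e (by omega)
      rw [h1.2.2] at hf ⊢
      have h2 := hp.nested e f hef hf hdes
      have h3 := hp.hook_lt e h1.1
      have h4 : (unhook n p).2 f = p.2 f := by simp only [unhook]; rw [if_neg (by omega)]
      rwa [h4]
    · rw [openCount_unhook hp hd (by omega), ← hs,
        openCount_succ_of_last hpn (hp.fix _ le_rfl)]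
  · rintro p ⟨⟨hp, -, -⟩, -, d, hd⟩ q ⟨⟨hq, -, -⟩, -, e, he⟩ h
    obtain ⟨σ, f⟩ := p
    obtain ⟨τ, g⟩ := q
    obtain ⟨rfl, h2⟩ := Prod.mk.inj h
    simp only at h2 hd he
    have hz : ∀ i, (if f i = n then 0 else f i) = if g i = n then 0 else g i := congrFun h2
    have hdn : d < n := by have := hp.lt_hook d (by simp only; omega); simp only at this; omega
    have hen : e < n := by have := hq.lt_hook e (by simp only; omega); simp only at this; omega
    -- If `d < e`, the first configuration hooks `e` before column `n`, and that hook survives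
    -- `unhook`; in the second one it is the hook at `e` that gets erased.
    have hde : d = e := by
      have h3 := hp.descent d (by simp only; omega)
      have h4 := hq.descent e (by simp only; omega)
      rcases lt_trichotomy d e with hde | hde | hde
      · have := hp.nested d e hde (by simp only; omega) h4
        have h5 := hz e
        simp only [he, if_true] at h5 this
        split_ifs at h5 <;> omega
      · exact hde
      · have := hq.nested e d hde (by simp only; omega) h3
        have h5 := hz d
        simp only [hd, if_true] at h5 this
        split_ifs at h5 <;> omega
    subst hde
    refine Prod.ext rfl (funext fun i => ?_)
    simp only
    by_cases hi : i = d
    · rw [hi, hd, he]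
    · have h5 : f i ≠ n := fun h => hi (hp.eq_of_hook_eq (by simp only; omega) (by simp only; omega))
      have h6 : g i ≠ n := fun h => hi (hq.eq_of_hook_eq (by simp only; omega) (by simp only; omega))
      have := hz i
      rwa [if_neg h5, if_neg h6] at this
  · rintro ⟨σ, f⟩ ⟨hp, hs, hQ⟩
    obtain ⟨d, hdn, hdes, hd0, hlast⟩ := exists_last_open (by omega : openCount n (σ, f) ≠ 0)
    simp only at hdes hd0 hlast
    have hfn : ∀ e, f e < n := fun e => by
      by_cases he : f e = 0
      · omega
      · exact hp.hook_lt e he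
    have key : ∀ e, (if e = d then n else f e) ≠ 0 → e = d ∨ f e ≠ 0 := by
      intro e he; split_ifs at he <;> simp_all
    have hun : unhook n (σ, fun e => if e = d then n else f e) = (σ, f) := by
      refine Prod.ext rfl (funext fun e => ?_)
      have := hfn e
      simp only [unhook]
      by_cases he : e = d
      · simp [he, hd0]
      · simp only [he, if_false]
        rw [if_neg (by omega)]
    have hvalid : IsPartialConfig (n + 1) (σ, fun e => if e = d then n else f e) := by
      refine ⟨hp.inj, fun i hi => hp.fix i (by omega), hp.avoid231, hp.avoid1243, fun e he => ?_,
        fun e he => ?_, fun e he => ?_, fun e he l hel hl => ?_, fun e g heg hg hgdes => ?_⟩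
      · rcases key e he with rfl | h
        · exact hdes
        · exact hp.descent e h
      · simp only at he ⊢
        split_ifs with h
        · omega
        · rw [if_neg h] at he
          exact hp.lt_hook e he
      · have := hfn e
        simp only
        split_ifs <;> omega
      · simp only at he hl ⊢
        split_ifs at he hl ⊢ with h
        · have h1 := hp.fix n le_rfl
          have h2 := hp.lt hl
          simp only at h1 h2
          omega
        · exact hp.below e he l hel hl
      · simp only at hg hgdes ⊢
        by_cases h : e = d
        · rw [if_pos h] at hg ⊢
          rw [if_neg (by omega)]
          exact ⟨hlast g hg (by omega) hgdes, hfn g⟩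
        · rw [if_neg h] at hg ⊢
          have h1 := hp.nested e g heg hg hgdes
          -- A hook already present cannot shelter `d`, since `d` was open.
          have h2 : g ≠ d := by
            rintro rfl
            exact h1.1 hd0
          rwa [if_neg h2]
    refine ⟨_, ⟨⟨hvalid, ?_, hQ⟩, hp.fix n le_rfl, d, if_pos rfl⟩, hun⟩
    have h1 := openCount_unhook hvalid (d := d) (if_pos rfl) (by omega)
    rw [hun] at h1
    have h2 := openCount_succ_of_last (p := (σ, fun e => if e = d then n else f e))
      (hp.fix n le_rfl) (hp.fix _ (Nat.le_succ n))
    omega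

lemma encard_last (Q : Prop) {n : ℕ} (hn : 1 ≤ n) (s : ℕ) :
    {p ∈ configs Q (n + 1) s | p.1 n = n}.encard =
      (configs Q n s).encard + (configs Q n (s + 1)).encard := by
  rw [← (bijOn_unhook Q hn s).image_eq, (bijOn_unhook Q hn s).injOn.encard_image,
    ← setOf_last_not_hooked Q hn s, ← Set.encard_union_eq]
  · congr 1
    ext p
    simp only [Set.mem_ofPred_eq, Set.mem_union]
    by_cases h : ∃ d, p.2 d = n
    · have : ¬ ∀ d, p.2 d ≠ n := fun h' => h.elim h'
      tauto
    · have : ∀ d, p.2 d ≠ n := fun d hd => h ⟨d, hd⟩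
      tauto
  · rw [Set.disjoint_left]
    rintro p ⟨-, -, h⟩ ⟨-, -, d, hd⟩
    exact h d hd

lemma IsPartialConfig.hook_zero_of_max {n : ℕ} {p : (ℕ → ℕ) × (ℕ → ℕ)}
    (hp : IsPartialConfig (n + 1) p) (h0 : p.1 0 = n) : p.2 0 = 0 := by
  by_contra h
  have h1 := hp.below 0 h 0 le_rfl (by omega)
  have h2 := hp.lt (hp.hook_lt 0 h)
  omega

lemma setOf_first (Q : Prop) {n : ℕ} (hn : 1 ≤ n) (s : ℕ) :
    {p ∈ configs Q (n + 1) (s + 1) | p.1 0 = n} = prepend n 0 '' configs Q n s := by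
  ext p
  constructor
  · rintro ⟨⟨hp, hs, hQ⟩, h0⟩
    have hh := hp.hook_zero_of_max h0
    have heq := prepend_deleteFirst hp
    rw [h0, hh] at heq
    refine ⟨deleteFirst p, ?_, heq⟩
    rw [← heq] at hp hs hQ
    obtain ⟨hq, -⟩ := isPartialConfig_prepend_iff.1 hp
    rw [openCount_prepend, if_pos ⟨hq.lt (by omega), rfl⟩] at hs
    exact ⟨hq, by omega, fun h => (avoids132_prepend.1 (hQ h)).1⟩
  · rintro ⟨p, ⟨hp, hs, hQ⟩, rfl⟩
    refine ⟨⟨isPartialConfig_prepend_iff.2 ⟨hp, ?_⟩, ?_,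
      fun h => avoids132_prepend.2 ⟨hQ h, ?_⟩⟩, rfl⟩
    · refine ⟨le_rfl, ?_, ?_, by simp, by simp, by simp, by simp, by simp⟩
      · rintro j k hjk ⟨h1, h2⟩
        have hj := hp.le_of_le h2
        have := hp.fix k (by omega)
        omega
      · rintro j k l hjk hkl ⟨h1, h2, h3⟩
        exact hp.not_lt_of_le hkl (h1.trans h2.le) h3
    · rw [openCount_prepend, hs, if_pos ⟨hp.lt (by omega), rfl⟩]
    · rintro j k hjk ⟨h1, h2⟩
      exact hp.not_lt_of_le hjk h1 h2

/-- A leading maximum starts a descent, and no higher point exists for its hook to reach. -/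
lemma setOf_first_zero (Q : Prop) {n : ℕ} (hn : 1 ≤ n) :
    {p ∈ configs Q (n + 1) 0 | p.1 0 = n} = ∅ := by
  rw [Set.eq_empty_iff_forall_notMem]
  rintro p ⟨⟨hp, hs, hQ⟩, h0⟩
  have hh := hp.hook_zero_of_max h0
  have heq := prepend_deleteFirst hp
  rw [h0, hh] at heq
  rw [← heq] at hp hs
  obtain ⟨hq, -⟩ := isPartialConfig_prepend_iff.1 hp
  rw [openCount_prepend, if_pos ⟨hq.lt (by omega), rfl⟩] at hs
  omega

end HookConfig

/-! ### Largest entry in the interior. -/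

namespace HookConfig

section middle

variable {n : ℕ} {p : (ℕ → ℕ) × (ℕ → ℕ)}

/-- If the largest entry is not the last one, the entries before it decrease. -/
lemma IsPartialConfig.decreasing_before_max (hp : IsPartialConfig (n + 1) p) {m i j : ℕ}
    (hm : p.1 m = n) (hmn : m < n) (hij : i < j) (hjm : j < m) : p.1 j < p.1 i := by
  have hjm' : p.1 j ≠ p.1 m := fun h => hjm.ne (hp.inj h)
  have hij' : p.1 i ≠ p.1 j := fun h => hij.ne (hp.inj h)
  have hmn' : p.1 n ≠ p.1 m := fun h => hmn.ne' (hp.inj h)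
  have hjn' : p.1 j ≠ p.1 n := fun h => (hjm.trans hmn).ne (hp.inj h)
  have h1 := hp.lt (Nat.lt_succ_self n)
  have h2 := hp.lt (show j < n + 1 by omega)
  -- Avoiding 231 puts `p.1 j` below the last entry; an ascent from `i` to `j` would then complete
  -- 1243 with the maximum and the last entry.
  have h3 := hp.avoid231 j m n hjm hmn
  have h4 := hp.avoid1243 i j m n hij hjm hmn
  omega

lemma IsPartialConfig.zero_of_max_one (hp : IsPartialConfig (n + 2) p) (h1 : p.1 1 = n + 1) :
    p.1 0 = 0 := by
  obtain ⟨k, hk⟩ := hp.surj 0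
  have h01 : p.1 0 ≠ p.1 1 := fun h => by simpa using hp.inj h
  have h0 := hp.lt (show 0 < n + 2 by omega)
  rcases k with _ | _ | k
  · exact hk
  · simp only [zero_add] at hk; omega
  · have := hp.avoid231 0 1 (k + 2) (by omega) (by omega)
    simp only [add_assoc, Nat.reduceAdd] at hk
    omega

lemma IsPartialConfig.exists_max (hp : IsPartialConfig (n + 1) p) : ∃ m ≤ n, p.1 m = n := by
  obtain ⟨m, hm⟩ := hp.surj n
  refine ⟨m, ?_, hm⟩
  by_contra h
  have := hp.fix m (by omega)
  omega

/-- A value strictly between the first two entries could not occur before the maximum, by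
monotonicity, nor after it, where it would complete 231 with the first entry and the maximum. -/
lemma IsPartialConfig.eq_succ_of_middle (hp : IsPartialConfig (n + 2) p) (h0 : p.1 0 ≠ n + 1)
    (h1 : p.1 1 ≠ n + 1) (hn : p.1 (n + 1) ≠ n + 1) : p.1 0 = p.1 1 + 1 := by
  obtain ⟨m, hmn, hm⟩ := hp.exists_max
  have hm2 : 1 < m := by
    rcases m with _ | _ | m
    · exact absurd hm h0
    · exact absurd hm h1
    · omega
  have hmn' : m < n + 1 := by
    rcases hmn.eq_or_lt with rfl | h
    · exact absurd hm hn
    · exact h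
  have h10 := hp.decreasing_before_max hm hmn' one_pos hm2
  by_contra hne
  obtain ⟨k, hk⟩ := hp.surj (p.1 1 + 1)
  have hk0 : k ≠ 0 := by rintro rfl; omega
  have hk1 : k ≠ 1 := by rintro rfl; omega
  have h0' := hp.lt (show 0 < n + 2 by omega)
  rcases lt_trichotomy k m with hkm | hkm | hkm
  · have := hp.decreasing_before_max hm hmn' (show 1 < k by omega) hkm
    omega
  · subst hkm
    omega
  · have := hp.avoid231 0 m k (by omega) hkm
    omega

lemma IsPartialConfig.hook_of_middle (hp : IsPartialConfig (n + 2) p) (h0 : p.1 0 ≠ n + 1)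
    (h1 : p.1 1 ≠ n + 1) (hn : p.1 (n + 1) ≠ n + 1) (hh : p.2 0 ≠ 0) :
    p.2 0 = 2 ∧ p.1 2 = n + 1 := by
  obtain ⟨m, hmn, hm⟩ := hp.exists_max
  have hm2 : 1 < m := by
    rcases m with _ | _ | m
    · exact absurd hm h0
    · exact absurd hm h1
    · omega
  have hmn' : m < n + 1 := by
    rcases hmn.eq_or_lt with rfl | h
    · exact absurd hm hn
    · exact h
  have hdec {i j : ℕ} := hp.decreasing_before_max (i := i) (j := j) hm hmn'
  have hlt := hp.hook_lt 0 hh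
  have hmax := hp.lt hlt
  have hbelow := hp.below 0 hh
  -- Before `m` the entries decrease, so no endpoint is high enough; beyond `m` the maximum would
  -- stick out above the hook.
  have hhm : p.2 0 = m := by
    rcases lt_trichotomy (p.2 0) m with h | h | h
    · have := hbelow 0 le_rfl (by omega)
      have := hdec (Nat.pos_of_ne_zero hh) h
      omega
    · exact h
    · have := hbelow m (by omega) h
      omega
  -- Otherwise column 1 is a sheltered descent, whose hook would have to end before `m`, inside the
  -- decreasing run.
  have hm3 : m = 2 := by
    by_contra hm3
    have h21 := hdec (show 1 < 2 by omega) (show 2 < m by omega)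
    have hnest := hp.nested 0 1 one_pos (by omega) h21
    have := hp.below 1 hnest.1 1 le_rfl (hp.lt_hook 1 hnest.1)
    have := hdec (hp.lt_hook 1 hnest.1) (by omega)
    omega
  subst hm3
  exact ⟨hhm, hm⟩

end middle

/-- The first entry is the minimum, so any 132 to its right would complete 1243; this is where
132-avoidance enters. -/
lemma setOf_max_one {n : ℕ} (s : ℕ) :
    {p ∈ configs False (n + 2) s | p.1 1 = n + 1} =
      prepend 0 0 '' {p ∈ configs True (n + 1) s | p.1 0 = n} := by
  ext p
  constructor
  · rintro ⟨⟨hp, hs, -⟩, h1⟩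
    have h0 := hp.zero_of_max_one h1
    have hh : p.2 0 = 0 := by
      by_contra h
      have := hp.descent 0 h
      omega
    have heq := prepend_deleteFirst hp
    rw [h0, hh] at heq
    refine ⟨deleteFirst p, ?_, heq⟩
    rw [← heq] at hp hs h1
    obtain ⟨hq, hcan⟩ := isPartialConfig_prepend_iff.1 hp
    rw [openCount_prepend, if_neg (by omega)] at hs
    refine ⟨⟨hq, hs, fun _ i j k hij hjk h => hcan.avoid1243 i j k hij hjk ⟨Nat.zero_le _, h⟩⟩, ?_⟩
    simpa using h1
  · rintro ⟨p, ⟨⟨hp, hs, hQ⟩, h0⟩, rfl⟩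
    refine ⟨⟨isPartialConfig_prepend_iff.2 ⟨hp, ?_⟩, ?_, False.elim⟩, by simpa using h0⟩
    · exact ⟨Nat.zero_le _, by simp, fun j k l hjk hkl h => hQ trivial j k l hjk hkl h.2, by simp,
        by simp, by simp, by simp, by simp⟩
    · rw [openCount_prepend, hs, if_neg (by omega), add_zero]

/-- By 231-avoidance only column 1 can hold a value below the first entry, so the first entry is 1.
Its descent is hooked, so deleting it leaves the open count unchanged. -/
lemma setOf_max_two_hooked {n : ℕ} (s : ℕ) :
    {p ∈ configs False (n + 3) s | p.1 2 = n + 2 ∧ p.2 0 = 2} =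
      prepend 1 2 '' {p ∈ configs False (n + 2) s | p.1 1 = n + 1} := by
  ext p
  constructor
  · rintro ⟨⟨hp, hs, -⟩, h2, hh⟩
    have hdes := hp.descent 0 (by omega)
    have h02 := hp.below 0 (by omega) 0 le_rfl (by omega)
    rw [hh] at h02
    have key : ∀ k, p.1 k < p.1 0 → k = 1 := by
      intro k hk
      have := hp.avoid231 0 2 k (by omega)
      by_contra hk1
      have hk0 : k ≠ 0 := by rintro rfl; omega
      have hk2 : k ≠ 2 := by rintro rfl; omega
      omega
    have h0 : p.1 0 = 1 := by
      by_contra h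
      obtain ⟨i, hi⟩ := hp.surj 0
      obtain ⟨j, hj⟩ := hp.surj 1
      have := key i (by omega)
      have := key j (by omega)
      subst i j
      omega
    have heq := prepend_deleteFirst hp
    rw [h0, hh] at heq
    refine ⟨deleteFirst p, ?_, heq⟩
    rw [← heq] at hp hs h2
    obtain ⟨hq, hcan⟩ := isPartialConfig_prepend_iff.1 hp
    rw [openCount_prepend, if_neg (by omega)] at hs
    refine ⟨⟨hq, hs, False.elim⟩, ?_⟩
    rw [prepend_fst_succ] at h2
    split_ifs at h2 <;> omega
  · rintro ⟨p, ⟨⟨hp, hs, -⟩, h1⟩, rfl⟩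
    have h0 := hp.zero_of_max_one h1
    refine ⟨⟨isPartialConfig_prepend_iff.2 ⟨hp, ?_⟩, ?_, False.elim⟩, ?_, rfl⟩
    · refine ⟨by omega, ?_, ?_, by omega, by omega, by simp; omega, ?_, ?_⟩
      · rintro j k hjk ⟨h, -⟩
        have : k = 0 := hp.inj (by omega)
        omega
      · rintro j k l hjk hkl ⟨h, h'⟩
        have hj : j ≠ 0 := by rintro rfl; omega
        exact hp.avoid1243 0 j k l (by omega) hjk hkl ⟨by omega, h'⟩
      · intro l hl
        obtain rfl : l = 0 := by omega
        simp; omega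
      · intro e he hdes
        obtain rfl : e = 0 := by omega
        omega
    · rw [openCount_prepend, hs, if_neg (by omega), add_zero]
    · rw [prepend_fst_succ, if_neg (by omega), h1]

/-- The first entry sits directly above the second in value, so it plays the same role in every
pattern and can be deleted and restored freely, at the cost of one open descent. -/
lemma setOf_middle_open (n s : ℕ) :
    {p ∈ middleConfigs (n + 1) (s + 1) | p.1 1 ≠ n + 1 ∧ p.2 0 = 0} =
      (fun p => prepend (p.1 0 + 1) 0 p) '' middleConfigs n s := by
  ext p
  constructor
  · rintro ⟨⟨⟨hp, hs, -⟩, h0, hn⟩, h1, hh⟩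
    have h01 := hp.eq_succ_of_middle h0 h1 hn
    have heq := prepend_deleteFirst hp
    have hv : p.1 0 = (deleteFirst p).1 0 + 1 := by
      simp only [deleteFirst, zero_add]
      rw [if_pos (by omega), h01]
    rw [hh, hv] at heq
    refine ⟨deleteFirst p, ?_, heq⟩
    rw [hv] at h0
    rw [← heq] at hp hs hn
    obtain ⟨hq, hcan⟩ := isPartialConfig_prepend_iff.1 hp
    rw [openCount_prepend, if_pos ⟨by omega, rfl⟩] at hs
    have := hcan.le
    refine ⟨⟨hq, by omega, False.elim⟩, by omega, ?_⟩
    rw [prepend_fst_succ] at hn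
    split_ifs at hn <;> omega
  · rintro ⟨p, ⟨⟨hp, hs, -⟩, h0, hn⟩, rfl⟩
    have h0' := hp.lt (Nat.succ_pos n)
    refine ⟨⟨⟨isPartialConfig_prepend_iff.2 ⟨hp, ?_⟩, ?_, False.elim⟩, ?_, ?_⟩, ?_, rfl⟩
    · refine ⟨h0', ?_, ?_, by simp, by simp, by simp, by simp, by simp⟩
      · rintro j k hjk ⟨h, h'⟩
        have hj : j ≠ 0 := by rintro rfl; omega
        have hk : p.1 k ≠ p.1 0 := fun h => by have := hp.inj h; omega
        exact hp.avoid231 0 j k (by omega) hjk ⟨by omega, by omega⟩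
      · rintro j k l hjk hkl ⟨h, h'⟩
        have hj : j ≠ 0 := by rintro rfl; omega
        exact hp.avoid1243 0 j k l (by omega) hjk hkl ⟨by omega, h'⟩
    · rw [openCount_prepend, hs, if_pos ⟨by omega, rfl⟩]
    · simp only [prepend_fst_zero]; omega
    · simp only [prepend_fst_succ]; split_ifs <;> omega
    · have := prepend_fst_succ (p.1 0 + 1) 0 p 0
      rw [if_pos (by omega)] at this
      simp only [zero_add] at this ⊢
      omega

lemma setOf_middle_open_zero (n : ℕ) :
    {p ∈ middleConfigs (n + 1) 0 | p.1 1 ≠ n + 1 ∧ p.2 0 = 0} = ∅ := by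
  rw [Set.eq_empty_iff_forall_notMem]
  rintro p ⟨⟨⟨hp, hs, -⟩, h0, hn⟩, h1, hh⟩
  have h01 := hp.eq_succ_of_middle h0 h1 hn
  have : 0 < openCount (n + 2) p := by
    unfold openCount
    rw [Finset.sum_range_succ', zero_add, if_pos ⟨by omega, hh⟩]
    omega
  exact this.ne' hs

lemma middleConfigs_zero (s : ℕ) : middleConfigs 0 s = ∅ := by
  rw [Set.eq_empty_iff_forall_notMem]
  rintro p ⟨⟨hp, -, -⟩, h0, -⟩
  have := hp.lt (show 0 < 1 by omega)
  omega

lemma middleConfigs_one (s : ℕ) : middleConfigs 1 s = ∅ := by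
  rw [Set.eq_empty_iff_forall_notMem]
  rintro p ⟨⟨hp, -, -⟩, h0, h1⟩
  obtain ⟨m, hm, hm'⟩ := hp.exists_max
  interval_cases m <;> contradiction

lemma encard_middleConfigs (n s : ℕ) :
    (middleConfigs (n + 2) s).encard =
      {p ∈ configs False (n + 3) s | p.1 1 = n + 2}.encard +
      -- For `n = 0` column 2 is the last one, so the maximum there is not interior.
      {p ∈ configs False (n + 3) s | p.1 2 = n + 2 ∧ p.2 0 = 2 ∧ n ≠ 0}.encard +
      {p ∈ middleConfigs (n + 2) s | p.1 1 ≠ n + 2 ∧ p.2 0 = 0}.encard := by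
  rw [← Set.encard_union_eq, ← Set.encard_union_eq]
  · congr 1
    ext p
    constructor
    · intro h
      by_cases h1 : p.1 1 = n + 2
      · exact Or.inl (Or.inl ⟨h.1, h1⟩)
      · by_cases h2 : p.2 0 = 0
        · exact Or.inr ⟨h, h1, h2⟩
        · have := h.1.1.hook_of_middle h.2.1 h1 h.2.2 h2
          refine Or.inl (Or.inr ⟨h.1, this.2, this.1, ?_⟩)
          rintro rfl
          exact h.2.2 this.2
    · rintro ((⟨h, h1⟩ | ⟨h, h1, h2, h3⟩) | h)
      · refine ⟨h, fun h0 => ?_, fun h0 => ?_⟩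
        · have := h.1.inj (h0.trans h1.symm)
          omega
        · have := h.1.inj (h0.trans h1.symm)
          omega
      · refine ⟨h, fun h0 => ?_, fun h0 => ?_⟩
        · have := h.1.inj (h0.trans h1.symm)
          omega
        · have := h.1.inj (h0.trans h1.symm)
          omega
      · exact h.1
  · rw [Set.disjoint_left]
    rintro p (h | h) h'
    · exact h'.2.1 h.2
    · have := h.2.2.1
      have := h'.2.2
      omega
  · rw [Set.disjoint_left]
    rintro p ⟨h, h1⟩ ⟨-, h2, -⟩
    have := h.1.inj (h1.trans h2.symm)
    omega

end HookConfig

/-! ### Counting recurrences. -/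

namespace HookConfig

/-- The number of partial configurations of length `n + 1` with `s` open descents that avoid
`132`. -/
def valleyCount : ℕ → ℕ → ℕ
  | 0, 0 => 1
  | 0, _ + 1 => 0
  | n + 1, 0 => valleyCount n 0 + valleyCount n 1
  | n + 1, s + 1 => valleyCount n (s + 1) + valleyCount n (s + 2) + valleyCount n s

/-- The number of partial configurations of length `n + 1 ≥ 2` with `s` open descents that avoid
`132` and start with their largest entry. -/
def valleyFirstCount : ℕ → ℕ → ℕ
  | n + 1, s + 1 => valleyCount n s
  | _, _ => 0

/-- The number of partial configurations of length `n + 1` with `s` open descents whose largest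
entry is neither first nor last. -/
def middleCount : ℕ → ℕ → ℕ
  | n + 2, s + 1 => valleyFirstCount (n + 1) (s + 1) + valleyFirstCount n (s + 1) +
      middleCount (n + 1) s
  | _, _ => 0

/-- The number of partial configurations of length `n + 1` with `s` open descents. -/
def configCount : ℕ → ℕ → ℕ
  | 0, 0 => 1
  | 0, _ + 1 => 0
  | n + 1, 0 => configCount n 0 + configCount n 1 + middleCount (n + 1) 0
  | n + 1, s + 1 => configCount n (s + 1) + configCount n (s + 2) + configCount n s +
      middleCount (n + 1) (s + 1)

lemma isPartialConfig_id (n : ℕ) : IsPartialConfig n (id, 0) where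
  inj := Function.injective_id
  fix _ _ := rfl
  avoid231 i j k hij hjk h := by simp only [id] at h; omega
  avoid1243 i j k l hij hjk hkl h := by simp only [id] at h; omega
  descent d h := absurd rfl h
  lt_hook d h := absurd rfl h
  hook_lt d h := absurd rfl h
  below d h := absurd rfl h
  nested d e _ h := absurd h (Nat.not_lt_zero e)

lemma openCount_id (n : ℕ) : openCount n (id, 0) = 0 := by simp [openCount]

lemma IsPartialConfig.eq_id {n : ℕ} (hn : n ≤ 1) {p : (ℕ → ℕ) × (ℕ → ℕ)}
    (hp : IsPartialConfig n p) : p = (id, 0) := by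
  refine Prod.ext (funext fun i => ?_) (funext fun i => ?_)
  · by_cases hi : n ≤ i
    · exact hp.fix i hi
    · have := hp.lt (not_le.1 hi)
      simp only [id]
      omega
  · by_contra h
    have h1 := hp.lt_hook i h
    have h2 := hp.hook_lt i h
    omega

lemma configs_zero_of_le_one (Q : Prop) {n : ℕ} (hn : n ≤ 1) : configs Q n 0 = {(id, 0)} := by
  ext p
  constructor
  · exact fun h => h.1.eq_id hn
  · rintro rfl
    refine ⟨isPartialConfig_id n, openCount_id n, fun _ i j k hij hjk h => ?_⟩
    simp only [id] at h
    omega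

lemma configs_succ_of_le_one (Q : Prop) {n : ℕ} (hn : n ≤ 1) (s : ℕ) :
    configs Q n (s + 1) = ∅ := by
  rw [Set.eq_empty_iff_forall_notMem]
  rintro p ⟨hp, hs, -⟩
  rw [hp.eq_id hn, openCount_id] at hs
  omega

lemma encard_first_succ (Q : Prop) {n : ℕ} (hn : 1 ≤ n) (s : ℕ) :
    {p ∈ configs Q (n + 1) (s + 1) | p.1 0 = n}.encard = (configs Q n s).encard := by
  rw [setOf_first Q hn s]
  exact (prepend_injective (fun _ => n) fun _ => 0).encard_image _

lemma encard_configs_true_succ {n : ℕ} (hn : 1 ≤ n) (s : ℕ) :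
    (configs True (n + 1) s).encard = (configs True n s).encard +
      (configs True n (s + 1)).encard + {p ∈ configs True (n + 1) s | p.1 0 = n}.encard := by
  rw [← encard_last True hn s, ← Set.encard_union_eq]
  · congr 1
    ext p
    constructor
    · intro h
      obtain ⟨m, hmn, hm⟩ := h.1.exists_max
      -- An interior maximum between the first and last entries would form 132 or 231, depending on
      -- which of the two is larger.
      have hav := h.2.2 trivial 0 m n
      have hav' := h.1.avoid231 0 m n
      have hn' := h.1.lt (Nat.lt_succ_self n)
      have h0' := h.1.lt (Nat.succ_pos n)
      by_cases h0 : p.1 0 = n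
      · exact Or.inr ⟨h, h0⟩
      · by_cases h1 : p.1 n = n
        · exact Or.inl ⟨h, h1⟩
        · exfalso
          have hm0 : m ≠ 0 := by rintro rfl; exact h0 hm
          have hmn : m ≠ n := by rintro rfl; exact h1 hm
          have h0n : p.1 0 ≠ p.1 n := fun h' => by have := h.1.inj h'; omega
          omega
    · rintro (h | h)
      · exact h.1
      · exact h.1
  · rw [Set.disjoint_left]
    rintro p ⟨h, h1⟩ ⟨-, h2⟩
    have := h.1.inj (h1.trans h2.symm)
    omega

lemma encard_configs_false_succ {n : ℕ} (hn : 1 ≤ n) (s : ℕ) :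
    (configs False (n + 1) s).encard = (configs False n s).encard +
      (configs False n (s + 1)).encard + {p ∈ configs False (n + 1) s | p.1 0 = n}.encard +
      (middleConfigs n s).encard := by
  rw [← encard_last False hn s, ← Set.encard_union_eq, ← Set.encard_union_eq]
  · congr 1
    ext p
    constructor
    · intro h
      by_cases h0 : p.1 0 = n
      · exact Or.inl (Or.inr ⟨h, h0⟩)
      · by_cases h1 : p.1 n = n
        · exact Or.inl (Or.inl ⟨h, h1⟩)
        · exact Or.inr ⟨h, h0, h1⟩
    · rintro ((h | h) | h)
      · exact h.1
      · exact h.1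
      · exact h.1
  · rw [Set.disjoint_left]
    rintro p (h | h) h'
    · exact h'.2.2 h.2
    · exact h'.2.1 h.2
  · rw [Set.disjoint_left]
    rintro p ⟨h, h1⟩ ⟨-, h2⟩
    have := h.1.inj (h1.trans h2.symm)
    omega

lemma encard_valley (n s : ℕ) : (configs True (n + 1) s).encard = valleyCount n s := by
  induction n generalizing s with
  | zero =>
    cases s with
    | zero => rw [configs_zero_of_le_one _ le_rfl]; simp [valleyCount]
    | succ s => rw [configs_succ_of_le_one _ le_rfl]; simp [valleyCount]
  | succ n ih =>
    rw [encard_configs_true_succ (by omega), ih, ih]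
    cases s with
    | zero => rw [setOf_first_zero _ (by omega)]; simp [valleyCount]
    | succ s => rw [encard_first_succ _ (by omega), ih]; simp [valleyCount]

lemma encard_valleyFirst {n : ℕ} (hn : 1 ≤ n) (s : ℕ) :
    {p ∈ configs True (n + 1) s | p.1 0 = n}.encard = valleyFirstCount n s := by
  obtain ⟨n, rfl⟩ : ∃ m, n = m + 1 := ⟨n - 1, by omega⟩
  cases s with
  | zero => rw [setOf_first_zero _ hn]; simp [valleyFirstCount]
  | succ s => rw [encard_first_succ _ hn, encard_valley]; simp [valleyFirstCount]

lemma encard_max_one {n : ℕ} (hn : 1 ≤ n) (s : ℕ) :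
    {p ∈ configs False (n + 2) s | p.1 1 = n + 1}.encard = valleyFirstCount n s := by
  rw [setOf_max_one, ← encard_valleyFirst hn]
  exact (prepend_injective (fun _ => 0) fun _ => 0).encard_image _

lemma encard_max_two_hooked (n s : ℕ) :
    {p ∈ configs False (n + 3) s | p.1 2 = n + 2 ∧ p.2 0 = 2 ∧ n ≠ 0}.encard =
      valleyFirstCount n s := by
  rcases Nat.eq_zero_or_pos n with rfl | hn
  · simp [valleyFirstCount]
  · simp only [ne_eq, hn.ne', not_false_eq_true, and_true]
    rw [setOf_max_two_hooked, ← encard_max_one hn]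
    exact (prepend_injective (fun _ => 1) fun _ => 2).encard_image _

lemma valleyFirstCount_zero (n : ℕ) : valleyFirstCount n 0 = 0 := by
  cases n <;> rfl

lemma encard_middle (n s : ℕ) : (middleConfigs n s).encard = middleCount n s := by
  induction n generalizing s with
  | zero => rw [middleConfigs_zero]; simp [middleCount]
  | succ n ih =>
    cases n with
    | zero => rw [middleConfigs_one]; simp [middleCount]
    | succ n =>
      rw [encard_middleConfigs, encard_max_one (by omega), encard_max_two_hooked]
      cases s with
      | zero =>
        rw [setOf_middle_open_zero (n + 1)]
        simp [middleCount, valleyFirstCount_zero]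
      | succ s =>
        rw [setOf_middle_open (n + 1) s,
          (prepend_injective (fun p => p.1 0 + 1) fun _ => 0).encard_image, ih]
        simp [middleCount]

lemma encard_configs (n s : ℕ) : (configs False (n + 1) s).encard = configCount n s := by
  induction n generalizing s with
  | zero =>
    cases s with
    | zero => rw [configs_zero_of_le_one _ le_rfl]; simp [configCount]
    | succ s => rw [configs_succ_of_le_one _ le_rfl]; simp [configCount]
  | succ n ih =>
    rw [encard_configs_false_succ (by omega), ih, ih, encard_middle]
    cases s with
    | zero => rw [setOf_first_zero _ (by omega)]; simp [configCount]
    | succ s => rw [encard_first_succ _ (by omega), ih]; simp [configCount]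

end HookConfig

/-! ### Generating functions. -/

namespace HookConfig

open PowerSeries

/-- The radicand factors as `(1 + x)(1 - 3x)`; the binomial series for `√(1 + x)` and its rescaling
by -3 supply the two roots. -/
lemma exists_sqrt_motzkin : ∃ S : ℚ⟦X⟧, constantCoeff S = 1 ∧ S ^ 2 = 1 - 2 * X - 3 * X ^ 2 := by
  have h1 : (PowerSeries.binomialSeries ℚ (1 / 2 : ℚ)) ^ 2 = 1 + X := by
    rw [sq, ← PowerSeries.binomialSeries_add]
    norm_num
    simpa using PowerSeries.binomialSeries_nat (R := ℚ) (A := ℚ) 1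
  have h0 : constantCoeff (PowerSeries.binomialSeries ℚ (1 / 2 : ℚ)) = 1 := by
    simp
  have hC : (C (-3 : ℚ) : ℚ⟦X⟧) = -3 := by rw [map_neg, map_ofNat]
  refine ⟨PowerSeries.binomialSeries ℚ (1 / 2 : ℚ) *
    rescale (-3) (PowerSeries.binomialSeries ℚ (1 / 2 : ℚ)), ?_, ?_⟩
  · rw [map_mul, h0, ← coeff_zero_eq_constantCoeff_apply (rescale _ _), coeff_rescale,
      coeff_zero_eq_constantCoeff_apply, h0]
    simp
  · rw [mul_pow, ← map_pow, h1, map_add, map_one, rescale_X, hC]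
    ring

/-- The factor `X` makes each coefficient depend only on coefficients of lower degree, so the system
has at most one solution although level `s + 1` refers upward to `s + 2`. -/
lemma eq_of_step_eq {a f g : ℕ → ℚ⟦X⟧} (f0 : f 0 = X * (f 0 + f 1) + a 0)
    (fs : ∀ s, f (s + 1) = X * (f (s + 1) + f (s + 2) + f s) + a (s + 1))
    (g0 : g 0 = X * (g 0 + g 1) + a 0)
    (gs : ∀ s, g (s + 1) = X * (g (s + 1) + g (s + 2) + g s) + a (s + 1)) : f = g := by
  have key (n : ℕ) : ∀ s, coeff n (f s) = coeff n (g s) := by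
    induction n with
    | zero =>
      rintro (_ | s)
      · rw [f0, g0]; simp
      · rw [fs, gs]; simp
    | succ n ih =>
      rintro (_ | s)
      · rw [f0, g0]; simp [coeff_succ_X_mul, ih]
      · rw [fs, gs]; simp [coeff_succ_X_mul, ih]
  exact funext fun s => PowerSeries.ext fun n => key n s

lemma valleySeries_zero : (mk fun n => (valleyCount n 0 : ℚ)) =
    X * ((mk fun n => (valleyCount n 0 : ℚ)) + mk fun n => (valleyCount n 1 : ℚ)) + 1 := by
  ext (_ | n) <;> simp [valleyCount, coeff_succ_X_mul, coeff_one]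

lemma valleySeries_succ (s : ℕ) : (mk fun n => (valleyCount n (s + 1) : ℚ)) =
    X * ((mk fun n => (valleyCount n (s + 1) : ℚ)) + (mk fun n => (valleyCount n (s + 2) : ℚ)) +
      mk fun n => (valleyCount n s : ℚ)) := by
  ext (_ | n) <;> simp [valleyCount, coeff_succ_X_mul]

lemma middleSeries_zero : (mk fun n => (middleCount n 0 : ℚ)) = 0 := by
  ext (_ | _ | n) <;> simp [middleCount]

lemma middleSeries_succ (s : ℕ) : (mk fun n => (middleCount n (s + 1) : ℚ)) =
    X * (mk fun n => (middleCount n s : ℚ)) +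
      X * (X * ((1 + X) * mk fun n => (valleyCount n s : ℚ))) := by
  ext (_ | _ | _ | n) <;>
    simp [middleCount, valleyFirstCount, coeff_succ_X_mul, add_mul]
  ring

lemma configSeries_zero : (mk fun n => (configCount n 0 : ℚ)) =
    X * ((mk fun n => (configCount n 0 : ℚ)) + mk fun n => (configCount n 1 : ℚ)) + 1 := by
  have h := middleSeries_zero
  ext (_ | n)
  · simp [configCount]
  · have := congrArg (coeff (n + 1)) h
    simp only [coeff_mk, map_zero, Nat.cast_eq_zero] at this
    simp [configCount, coeff_succ_X_mul, coeff_one, this]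

lemma configSeries_succ (s : ℕ) : (mk fun n => (configCount n (s + 1) : ℚ)) =
    X * ((mk fun n => (configCount n (s + 1) : ℚ)) + (mk fun n => (configCount n (s + 2) : ℚ)) +
      mk fun n => (configCount n s : ℚ)) + mk fun n => (middleCount n (s + 1) : ℚ) := by
  ext (_ | n) <;> simp [configCount, middleCount, coeff_succ_X_mul]

lemma valleySeries_eq {t : ℚ⟦X⟧} (ht : t = X * (1 + t + t ^ 2)) (s : ℕ) :
    (mk fun n => (valleyCount n s : ℚ)) = (1 + t + t ^ 2) * t ^ s := by
  refine congrFun (eq_of_step_eq (a := fun s => if s = 0 then 1 else 0)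
    (f := fun s => mk fun n => (valleyCount n s : ℚ)) (g := fun s => (1 + t + t ^ 2) * t ^ s)
    ?_ (fun s => ?_) ?_ fun s => ?_) s
  · simpa using valleySeries_zero
  · simpa using valleySeries_succ s
  · simp only [if_true]
    linear_combination (1 + t) * ht
  · simp only [Nat.add_eq_zero_iff, one_ne_zero, and_false, if_false]
    linear_combination (t ^ s * (1 + t + t ^ 2)) * ht

lemma middleSeries_eq {t : ℚ⟦X⟧} (ht : t = X * (1 + t + t ^ 2)) (s : ℕ) :
    (mk fun n => (middleCount n s : ℚ)) =
      (1 + X) * X * t * ∑ i ∈ Finset.range s, t ^ i * X ^ (s - 1 - i) := by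
  induction s with
  | zero => simp [middleSeries_zero]
  | succ s ih =>
    rw [middleSeries_succ, ih, valleySeries_eq ht, Nat.add_sub_cancel, geom_sum₂_succ_eq]
    linear_combination (-X * (1 + X) * t ^ s) * ht

/-- The homogeneous recursion has solution `tˢ`. The forcing term is a multiple of `D s`, formally
`(tˢ - xˢ)/(t - x)`: its `xˢ` part is answered by `-t * D s`, while its `tˢ` part is resonant and
produces the factor linear in `s`. The equation at `s = 0` fixes the multiple of `tˢ`. -/
lemma configSeries_zero_mul {t : ℚ⟦X⟧} (ht : t = X * (1 + t + t ^ 2)) :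
    (mk fun n => (configCount n 0 : ℚ)) * (1 - t) = 1 := by
  have ht0 : constantCoeff t = 0 := by rw [ht]; simp
  have hI : (1 - t) * (1 - t)⁻¹ = 1 := PowerSeries.mul_inv_cancel _ (by simp [ht0])
  set I := (1 - t)⁻¹
  set D : ℕ → ℚ⟦X⟧ := fun s => ∑ i ∈ Finset.range s, t ^ i * X ^ (s - 1 - i) with hD
  have hDs (s : ℕ) : D (s + 1) = X * D s + t ^ s := by
    simp only [hD]
    rw [Nat.add_sub_cancel, geom_sum₂_succ_eq, add_comm]
  have hD0 : D 0 = 0 := by simp [hD]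
  have key := congrFun (eq_of_step_eq
    (a := fun s => if s = 0 then 1 else mk fun n => (middleCount n s : ℚ))
    (f := fun s => mk fun n => (configCount n s : ℚ))
    (g := fun s => -t * D s + (s + 1 : ℚ⟦X⟧) * t ^ s * I)
    ?_ (fun s => ?_) ?_ fun s => ?_) 0
  · simp only [hD0, Nat.cast_zero, pow_zero] at key
    rw [key]
    linear_combination hI
  · simpa using configSeries_zero
  · simpa using configSeries_succ s
  · have hD1 := hDs 0
    rw [hD0] at hD1
    simp only [if_true, hD0, hD1]
    push_cast
    linear_combination I * ht + (1 - X * t) * hI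
  · simp only [Nat.add_eq_zero_iff, one_ne_zero, and_false, if_false]
    rw [middleSeries_eq ht]
    change _ = _ + (1 + X) * X * t * D (s + 1)
    have h1 := hDs s
    have h2 := hDs (s + 1)
    push_cast
    linear_combination X * t * h2 - t * h1 + ((s + 2 : ℚ⟦X⟧) * t ^ s * I - t ^ s) * ht +
      t ^ s * X * (1 + t) * hI

end HookConfig

/-! ### From hooks in the plane to partial configurations. -/

namespace HookConfig

lemma contains_p231_iff {n : ℕ} (π : Equiv.Perm (Fin n)) :
    Contains π p231 ↔ ∃ i j k, i < j ∧ j < k ∧ π k < π i ∧ π i < π j := by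
  constructor
  · rintro ⟨f, hf⟩
    exact ⟨f 0, f 1, f 2, f.lt_iff_lt.2 (by decide), f.lt_iff_lt.2 (by decide),
      (hf 2 0).2 (by decide), (hf 0 1).2 (by decide)⟩
  · rintro ⟨i, j, k, hij, hjk, hki, hij'⟩
    have hmono : StrictMono ![i, j, k] := by
      intro a b hab
      fin_cases a <;> fin_cases b <;> simp at hab ⊢ <;> order
    refine ⟨OrderEmbedding.ofStrictMono _ hmono, fun a b => ?_⟩
    fin_cases a <;> fin_cases b <;> simp [p231] <;> order

lemma contains_p1243_iff {n : ℕ} (π : Equiv.Perm (Fin n)) :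
    Contains π p1243 ↔
      ∃ i j k l, i < j ∧ j < k ∧ k < l ∧ π i < π j ∧ π j < π l ∧ π l < π k := by
  constructor
  · rintro ⟨f, hf⟩
    exact ⟨f 0, f 1, f 2, f 3, f.lt_iff_lt.2 (by decide), f.lt_iff_lt.2 (by decide),
      f.lt_iff_lt.2 (by decide), (hf 0 1).2 (by decide), (hf 1 3).2 (by decide),
      (hf 3 2).2 (by decide)⟩
  · rintro ⟨i, j, k, l, hij, hjk, hkl, hij', hjl, hlk⟩
    have hmono : StrictMono ![i, j, k, l] := by
      intro a b hab
      fin_cases a <;> fin_cases b <;> simp at hab ⊢ <;> order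
    refine ⟨OrderEmbedding.ofStrictMono _ hmono, fun a b => ?_⟩
    fin_cases a <;> fin_cases b <;> simp [p1243] <;> order

/-- The extension of a permutation of `Fin n` to `ℕ` by the identity. -/
def extend {n : ℕ} (π : Equiv.Perm (Fin n)) (i : ℕ) : ℕ :=
  if h : i < n then π ⟨i, h⟩ else i

section extend

variable {n : ℕ} (π : Equiv.Perm (Fin n))

lemma extend_of_lt {i : ℕ} (h : i < n) : extend π i = π ⟨i, h⟩ := dif_pos h

lemma extend_of_le {i : ℕ} (h : n ≤ i) : extend π i = i := dif_neg (not_lt.2 h)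

@[simp] lemma extend_val (i : Fin n) : extend π i = π i := extend_of_lt π i.2

lemma extend_lt {i : ℕ} (h : i < n) : extend π i < n := by
  rw [extend_of_lt π h]; exact (π ⟨i, h⟩).2

lemma lt_of_inversion {i j : ℕ} (hij : i < j) (h : extend π j < extend π i) : j < n := by
  by_contra hj
  rw [extend_of_le π (not_lt.1 hj)] at h
  by_cases hi : i < n
  · have := extend_lt π hi
    omega
  · rw [extend_of_le π (not_lt.1 hi)] at h
    omega

lemma extend_injective : Function.Injective (extend π) := by
  intro i j h
  by_cases hi : i < n <;> by_cases hj : j < n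
  · rw [extend_of_lt π hi, extend_of_lt π hj] at h
    simpa using π.injective (Fin.ext h)
  · have := extend_lt π hi
    rw [extend_of_le π (not_lt.1 hj)] at h
    omega
  · have := extend_lt π hj
    rw [extend_of_le π (not_lt.1 hi)] at h
    omega
  · rwa [extend_of_le π (not_lt.1 hi), extend_of_le π (not_lt.1 hj)] at h

lemma isDescent_iff (d : Fin n) : IsDescent π d ↔ extend π (d + 1) < extend π d := by
  constructor
  · rintro ⟨h, hd⟩
    rw [extend_of_lt π h, extend_val]
    exact hd
  · intro hd
    have h := lt_of_inversion π (Nat.lt_succ_self _) hd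
    rw [Nat.succ_eq_add_one] at h
    rw [extend_of_lt π h, extend_val] at hd
    exact ⟨h, hd⟩

lemma avoids231_extend_iff : ¬ Contains π p231 ↔
    ∀ i j k, i < j → j < k → ¬ (extend π k < extend π i ∧ extend π i < extend π j) := by
  rw [contains_p231_iff]
  constructor
  · rintro h i j k hij hjk ⟨h1, h2⟩
    have hk := lt_of_inversion π (hij.trans hjk) h1
    have hi : i < n := by omega
    have hj : j < n := by omega
    rw [extend_of_lt π hk, extend_of_lt π hi] at h1
    rw [extend_of_lt π hi, extend_of_lt π hj] at h2
    exact h ⟨⟨i, hi⟩, ⟨j, hj⟩, ⟨k, hk⟩, hij, hjk, h1, h2⟩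
  · rintro h ⟨i, j, k, hij, hjk, h1, h2⟩
    exact h i j k hij hjk (by simpa using ⟨h1, h2⟩)

lemma avoids1243_extend_iff : ¬ Contains π p1243 ↔
    ∀ i j k l, i < j → j < k → k < l → ¬ (extend π i < extend π j ∧ extend π j < extend π l ∧
      extend π l < extend π k) := by
  rw [contains_p1243_iff]
  constructor
  · rintro h i j k l hij hjk hkl ⟨h1, h2, h3⟩
    have hl := lt_of_inversion π hkl h3
    have hi : i < n := by omega
    have hj : j < n := by omega
    have hk : k < n := by omega
    rw [extend_of_lt π hi, extend_of_lt π hj] at h1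
    rw [extend_of_lt π hj, extend_of_lt π hl] at h2
    rw [extend_of_lt π hl, extend_of_lt π hk] at h3
    exact h ⟨⟨i, hi⟩, ⟨j, hj⟩, ⟨k, hk⟩, ⟨l, hl⟩, hij, hjk, hkl, h1, h2, h3⟩
  · rintro h ⟨i, j, k, l, hij, hjk, hkl, h1, h2, h3⟩
    exact h i j k l hij hjk hkl (by simpa using ⟨h1, h2, h3⟩)

end extend

section hooks

variable {n : ℕ} {π : Equiv.Perm (Fin n)}

/-- Only the horizontal segment matters: the one plot point in the column of the vertical segment is
its lower end. -/
lemma Hook.not_above_iff (H : Hook π) :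
    (∀ l : Fin n, ∀ q ∈ H.points, ¬ (q.1 = (plotPoint π l).1 ∧ q.2 < (plotPoint π l).2)) ↔
      ∀ l, H.sw ≤ l → l ≤ H.ne → π l ≤ π H.ne := by
  constructor
  · intro h l h1 h2
    by_contra hlt
    refine h l ((plotPoint π l).1, (plotPoint π H.ne).2) (Or.inr ⟨rfl, ?_, ?_⟩) ⟨rfl, ?_⟩
    · simpa [plotPoint] using h1
    · simpa [plotPoint] using h2
    · simpa [plotPoint] using hlt
  · rintro h l ⟨a, b⟩ (⟨h1, h2, h3⟩ | ⟨h1, h2, h3⟩) ⟨h4, h5⟩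
    · simp only [plotPoint] at h1 h2 h3 h4 h5
      have : H.sw = l := by
        rw [h1] at h4
        exact Fin.ext (by exact_mod_cast h4)
      subst this
      exact absurd h5 (not_lt.2 h2)
    · simp only [plotPoint] at h1 h2 h3 h4 h5
      rw [h4] at h2 h3
      have := h l (by exact_mod_cast h2) (by exact_mod_cast h3)
      rw [h1] at h5
      exact absurd (show π H.ne < π l by exact_mod_cast h5) (not_lt.2 this)

/-- With `H` starting further left, the contact to be excluded is the vertical part of `K` meeting
the horizontal part of `H` left of its end, or both horizontals sharing a height, which forces a
common endpoint. -/
lemma Hook.inter_iff {H K : Hook π} (hH : ∀ l, H.sw ≤ l → l ≤ H.ne → π l ≤ π H.ne)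
    (hK : ∀ l, K.sw ≤ l → l ≤ K.ne → π l ≤ π K.ne) (hlt : H.sw < K.sw) :
    (∀ q ∈ H.points ∩ K.points, (q = plotPoint π H.ne ∧ q = plotPoint π K.sw) ∨
      (q = plotPoint π H.sw ∧ q = plotPoint π K.ne)) ↔ (K.sw < H.ne → K.ne < H.ne) := by
  constructor
  · intro h hs
    by_contra hne
    have h1 := hK H.ne hs.le (not_lt.1 hne)
    have h2 := hH K.sw hlt.le hs.le
    -- The point where the vertical of `K` crosses the horizontal of `H`.
    have hq : (((K.sw : ℕ) : ℝ), ((π H.ne : ℕ) : ℝ)) ∈ H.points ∩ K.points := by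
      refine ⟨Or.inr ⟨rfl, ?_, ?_⟩, Or.inl ⟨rfl, ?_, ?_⟩⟩
      · simpa [plotPoint] using hlt.le
      · simpa [plotPoint] using hs.le
      · simpa [plotPoint] using h2
      · simpa [plotPoint] using h1
    rcases h _ hq with h | h
    · have := congrArg Prod.fst h.1
      simp only [plotPoint, Nat.cast_inj] at this
      exact hs.ne (Fin.ext this)
    · have := congrArg Prod.fst h.1
      simp only [plotPoint, Nat.cast_inj] at this
      exact hlt.ne' (Fin.ext this)
  · rintro h ⟨a, b⟩ ⟨hqH, hqK⟩
    have hsw : (H.sw : ℝ) < ((K.sw : ℕ) : ℝ) := by exact_mod_cast hlt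
    have hKne : ((K.sw : ℕ) : ℝ) < ((K.ne : ℕ) : ℝ) := by exact_mod_cast K.sw_lt_ne
    simp only [Hook.points, plotPoint, Set.mem_union, Set.mem_ofPred_eq] at hqH hqK
    rcases hqH with ⟨h1, h2, h3⟩ | ⟨h1, h2, h3⟩
    · rcases hqK with ⟨k1, k2, k3⟩ | ⟨k1, k2, k3⟩
      · exact absurd (h1.symm.trans k1) hsw.ne
      · rw [h1] at k2
        exact absurd k2 (not_le.2 hsw)
    · rcases hqK with ⟨k1, k2, k3⟩ | ⟨k1, k2, k3⟩
      · have hle : K.sw ≤ H.ne := by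
          rw [k1] at h3
          exact_mod_cast h3
        rcases hle.eq_or_lt with heq | hlt'
        · refine Or.inl ⟨?_, ?_⟩
          · rw [h1, k1, heq]; rfl
          · rw [h1, k1, ← heq]; rfl
        · have hne := h hlt'
          have h5 := hH K.ne (hlt.le.trans K.sw_lt_ne.le) hne.le
          rw [h1] at k3
          have h6 : π H.ne ≤ π K.ne := by exact_mod_cast k3
          exact absurd (π.injective (le_antisymm h5 h6)) hne.ne
      · have h5 : H.ne = K.ne := by
          rw [h1] at k1
          exact π.injective (Fin.ext (by exact_mod_cast k1))
        have h6 := h (h5 ▸ K.sw_lt_ne)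
        exact absurd h5.symm h6.ne

end hooks

open Classical in
/-- The columns of the northeast endpoints of the hooks of a valid hook configuration. -/
noncomputable def VHC.hookEnd {n : ℕ} {π : Equiv.Perm (Fin n)} (H : VHC π) (d : ℕ) : ℕ :=
  if h : ∃ h : d < n, IsDescent π ⟨d, h⟩ then (H.hook ⟨⟨d, h.1⟩, h.2⟩).ne else 0

/-- A valid hook configuration as a partial configuration. -/
noncomputable def toConfig {n : ℕ} (x : Σ π : Equiv.Perm (Fin n), VHC π) : (ℕ → ℕ) × (ℕ → ℕ) :=
  (extend x.1, x.2.hookEnd)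

section toConfig

variable {n : ℕ} {π : Equiv.Perm (Fin n)}

lemma VHC.hookEnd_val (H : VHC π) (d : {d // IsDescent π d}) :
    H.hookEnd (d.1 : ℕ) = (H.hook d).ne := by
  rw [VHC.hookEnd, dif_pos ⟨d.1.2, d.2⟩]

lemma VHC.exists_of_hookEnd_ne_zero (H : VHC π) {d : ℕ} (h : H.hookEnd d ≠ 0) :
    ∃ e : {d // IsDescent π d}, d = (e.1 : ℕ) := by
  rw [VHC.hookEnd] at h
  split_ifs at h with h'
  · exact ⟨⟨⟨d, h'.1⟩, h'.2⟩, rfl⟩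
  · exact absurd rfl h

lemma exists_of_extend_descent {d : ℕ} (h : extend π (d + 1) < extend π d) :
    ∃ e : {d // IsDescent π d}, d = (e.1 : ℕ) := by
  have hd : d < n := by
    have := lt_of_inversion π (Nat.lt_succ_self d) h
    omega
  exact ⟨⟨⟨d, hd⟩, (isDescent_iff π _).2 h⟩, rfl⟩

lemma VHC.val_lt_hookEnd (H : VHC π) (d : {d // IsDescent π d}) :
    (d.1 : ℕ) < H.hookEnd d.1 := by
  have := (H.hook d).sw_lt_ne
  rw [H.sw_hook] at this
  rw [H.hookEnd_val]
  exact this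

lemma VHC.le_ne (H : VHC π) (d : {d // IsDescent π d}) :
    ∀ l, (H.hook d).sw ≤ l → l ≤ (H.hook d).ne → π l ≤ π (H.hook d).ne :=
  (H.hook d).not_above_iff.1 (H.not_above d)

lemma isPartialConfig_toConfig (H : VHC π) (h231 : ¬ Contains π p231)
    (h1243 : ¬ Contains π p1243) : IsPartialConfig n (toConfig ⟨π, H⟩) where
  inj := extend_injective π
  fix i hi := extend_of_le π hi
  avoid231 := (avoids231_extend_iff π).1 h231
  avoid1243 := (avoids1243_extend_iff π).1 h1243
  descent d hd := by
    obtain ⟨e, rfl⟩ := H.exists_of_hookEnd_ne_zero hd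
    exact (isDescent_iff π _).1 e.2
  lt_hook d hd := by
    obtain ⟨e, rfl⟩ := H.exists_of_hookEnd_ne_zero hd
    exact H.val_lt_hookEnd e
  hook_lt d hd := by
    obtain ⟨e, rfl⟩ := H.exists_of_hookEnd_ne_zero hd
    simp only [toConfig, H.hookEnd_val]
    exact (H.hook e).ne.2
  below d hd l hdl hl := by
    obtain ⟨e, rfl⟩ := H.exists_of_hookEnd_ne_zero hd
    simp only [toConfig, H.hookEnd_val] at hl ⊢
    have hln : l < n := hl.trans (H.hook e).ne.2
    rw [extend_of_lt π hln, extend_val]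
    have h1 := H.le_ne e ⟨l, hln⟩ (by rw [H.sw_hook]; exact hdl) hl.le
    refine lt_of_le_of_ne h1 fun h => ?_
    have := congrArg Fin.val (π.injective (Fin.ext h))
    exact hl.ne this
  nested d e hde he hdes := by
    obtain ⟨e, rfl⟩ := exists_of_extend_descent hdes
    obtain ⟨d, rfl⟩ := H.exists_of_hookEnd_ne_zero (Nat.ne_zero_of_lt he)
    have h1 := H.val_lt_hookEnd e
    simp only [toConfig] at he ⊢
    refine ⟨by omega, ?_⟩
    rw [H.hookEnd_val] at he ⊢
    rw [H.hookEnd_val]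
    have hsw : (H.hook d).sw < (H.hook e).sw := by rw [H.sw_hook, H.sw_hook]; exact hde
    have hne : d ≠ e := by rintro rfl; exact absurd hde (lt_irrefl _)
    exact (Hook.inter_iff (H.le_ne d) (H.le_ne e) hsw).1 (H.inter d e hne)
      (by rw [H.sw_hook]; exact he)

lemma openCount_toConfig (H : VHC π) : openCount n (toConfig ⟨π, H⟩) = 0 := by
  refine Finset.sum_eq_zero fun d _ => if_neg ?_
  rintro ⟨h1, h2⟩
  obtain ⟨e, rfl⟩ := exists_of_extend_descent h1
  have := H.val_lt_hookEnd e
  simp only [toConfig] at h2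
  omega

lemma toConfig_injective : Function.Injective (toConfig (n := n)) := by
  rintro ⟨π, H⟩ ⟨π', H'⟩ h
  obtain ⟨h1, h2⟩ := Prod.mk.inj h
  simp only at h1 h2
  have hπ : π = π' := Equiv.ext fun i => Fin.ext (by
    simpa using congrFun h1 i)
  subst hπ
  congr 1
  refine VHC.ext (funext fun d => Hook.ext ?_ (Fin.ext ?_))
  · rw [H.sw_hook, H'.sw_hook]
  · rw [← H.hookEnd_val, ← H'.hookEnd_val, h2]

/-- With no open descents, the second component assigns a hook to every descent, as a valid hook
configuration requires. -/
lemma exists_toConfig_eq {p : (ℕ → ℕ) × (ℕ → ℕ)} (hp : IsPartialConfig n p)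
    (hs : openCount n p = 0) : ∃ x, toConfig (n := n) x = p := by
  have hopen (d : ℕ) (h : p.1 (d + 1) < p.1 d) : p.2 d ≠ 0 := by
    intro h0
    have hd : d < n := by
      by_contra hd
      have h1 := hp.fix d (by omega)
      have h2 := hp.fix (d + 1) (by omega)
      omega
    have := Finset.sum_eq_zero_iff.1 hs d (Finset.mem_range.2 hd)
    simp [h, h0] at this
  have hinj : Function.Injective fun i : Fin n => (⟨p.1 i, hp.lt i.2⟩ : Fin n) :=
    fun i j h => Fin.ext (hp.inj (congrArg Fin.val h))
  let π : Equiv.Perm (Fin n) := Equiv.ofBijective _ (Finite.injective_iff_bijective.1 hinj)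
  have hπ : extend π = p.1 := by
    funext i
    by_cases hi : i < n
    · rw [extend_of_lt π hi]; rfl
    · rw [extend_of_le π (not_lt.1 hi), hp.fix i (not_lt.1 hi)]
  have hdes (d : {d // IsDescent π d}) : p.2 (d.1 : ℕ) ≠ 0 :=
    hopen _ (by rw [← hπ]; exact (isDescent_iff π _).1 d.2)
  let hook (d : {d // IsDescent π d}) : Hook π :=
    { sw := d.1
      ne := ⟨p.2 d.1, hp.hook_lt _ (hdes d)⟩
      sw_lt_ne := hp.lt_hook _ (hdes d)
      height_lt := hp.below _ (hdes d) _ le_rfl (hp.lt_hook _ (hdes d)) }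
  have hle (d : {d // IsDescent π d}) (l : Fin n) (h1 : (hook d).sw ≤ l) (h2 : l ≤ (hook d).ne) :
      π l ≤ π (hook d).ne := by
    rcases h2.eq_or_lt with rfl | h2
    · exact le_rfl
    · exact (show π l < π (hook d).ne from hp.below _ (hdes d) l h1 h2).le
  have hnest (d e : {d // IsDescent π d}) (hde : d.1 < e.1) (he : e.1 < (hook d).ne) :
      (hook e).ne < (hook d).ne :=
    (hp.nested d.1 e.1 hde he (by rw [← hπ]; exact (isDescent_iff π _).1 e.2)).2
  let H : VHC π :=
    { hook := hook
      sw_hook := fun _ => rfl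
      not_above := fun d => (hook d).not_above_iff.2 (hle d)
      inter := fun d e hne q hq => by
        rcases lt_or_gt_of_ne (fun h => hne (Subtype.ext h) : d.1 ≠ e.1) with h | h
        · exact (Hook.inter_iff (hle d) (hle e) h).2 (hnest d e h) q hq
        · exact ((Hook.inter_iff (hle e) (hle d) h).2 (hnest e d h) q hq.symm).symm.imp
            And.symm And.symm }
  refine ⟨⟨π, H⟩, Prod.ext hπ (funext fun d => ?_)⟩
  simp only [toConfig]
  by_cases h : extend π (d + 1) < extend π d
  · obtain ⟨e, rfl⟩ := exists_of_extend_descent h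
    rw [H.hookEnd_val]
  · have h1 : p.2 d = 0 := by
      by_contra h0
      exact h (by rw [hπ]; exact hp.descent d h0)
    rw [h1]
    by_contra h0
    obtain ⟨e, rfl⟩ := H.exists_of_hookEnd_ne_zero h0
    exact h ((isDescent_iff π _).1 e.2)

lemma image_toConfig (n : ℕ) :
    toConfig '' VHCs (Av n {⟨3, p231⟩, ⟨4, p1243⟩}) = configs False n 0 := by
  ext p
  constructor
  · rintro ⟨⟨π, H⟩, hx, rfl⟩
    exact ⟨isPartialConfig_toConfig H (hx ⟨3, p231⟩ (by simp)) (hx ⟨4, p1243⟩ (by simp)),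
      openCount_toConfig H, False.elim⟩
  · rintro ⟨hp, hs, -⟩
    obtain ⟨⟨π, H⟩, rfl⟩ := exists_toConfig_eq hp hs
    refine ⟨⟨π, H⟩, ?_, rfl⟩
    rintro τ (rfl | rfl)
    · exact (avoids231_extend_iff π).2 hp.avoid231
    · exact (avoids1243_extend_iff π).2 hp.avoid1243

end toConfig

lemma ncard_VHCs_eq (n : ℕ) :
    (VHCs (Av n {⟨3, p231⟩, ⟨4, p1243⟩})).ncard = (configs False n 0).encard.toNat := by
  rw [← image_toConfig, toConfig_injective.encard_image]
  rfl

lemma ncard_VHCs_zero : (VHCs (Av 0 {⟨3, p231⟩, ⟨4, p1243⟩})).ncard = 1 := by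
  rw [ncard_VHCs_eq, configs_zero_of_le_one _ (Nat.zero_le 1)]
  simp

lemma ncard_VHCs_succ (n : ℕ) :
    (VHCs (Av (n + 1) {⟨3, p231⟩, ⟨4, p1243⟩})).ncard = configCount n 0 := by
  rw [ncard_VHCs_eq, encard_configs]
  simp

end HookConfig

/-! ### The square root and the closed form. -/

open PowerSeries in
/-- If `S` is the square root of `1 - 2x - 3x²` with constant term `1`, then
`S = 1 - x - 2xt` where `t = x(1 + t + t²)`. -/
lemma exists_motzkin_of_sq_eq {S : ℚ⟦X⟧} (h0 : constantCoeff S = 1)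
    (hS : S ^ 2 = 1 - 2 * X - 3 * X ^ 2) :
    ∃ t : ℚ⟦X⟧, t = X * (1 + t + t ^ 2) ∧ S = 1 - X - 2 * X * t := by
  obtain ⟨u, hu⟩ : X ∣ 1 - X - S := by
    rw [X_dvd_iff]
    simp [h0]
  have h2 : (2 : ℚ⟦X⟧) * C (1 / 2 : ℚ) = 1 := by
    rw [← map_ofNat (C : ℚ →+* ℚ⟦X⟧) 2, ← map_mul]
    norm_num
  refine ⟨C (1 / 2 : ℚ) * u, ?_, ?_⟩
  · generalize hc : (C (1 / 2 : ℚ) : ℚ⟦X⟧) = c at h2 ⊢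
    have hSu : S = 1 - X - 2 * X * (c * u) := by
      linear_combination -hu + X * u * h2
    have h4 : (4 : ℚ⟦X⟧) ≠ 0 := fun h => by
      simpa using (map_ofNat (constantCoeff (R := ℚ)) 4).symm.trans (congrArg _ h)
    -- Expanding `S²` yields the quadratic equation for `t` only after multiplication by `4X`, so
    -- this factor is cancelled.
    have hX : (4 * X : ℚ⟦X⟧) ≠ 0 := mul_ne_zero h4 X_ne_zero
    refine mul_left_cancel₀ hX ?_
    rw [hSu] at hS
    linear_combination -hS
  · linear_combination -hu + X * u * h2

theorem mainTheorem6 :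
    ∃ S : PowerSeries ℚ,
      -- `S` is the formal power series `√(1 - 2x - 3x²)`
      (PowerSeries.constantCoeff S = 1 ∧ S ^ 2 = 1 - 2 * PowerSeries.X - 3 * PowerSeries.X ^ 2) ∧
      -- the quotient is taken in the field of formal Laurent series
      (3 * PowerSeries.X - 1 + S : PowerSeries ℚ) ≠ 0 ∧
      ((PowerSeries.mk fun n : ℕ =>
          ((HookConfig.VHCs (HookConfig.Av n
            {⟨3, HookConfig.p231⟩, ⟨4, HookConfig.p1243⟩})).ncard : ℚ) : PowerSeries ℚ) :
          LaurentSeries ℚ) =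
        1 + ((2 * PowerSeries.X ^ 2 : PowerSeries ℚ) : LaurentSeries ℚ) /
          ((3 * PowerSeries.X - 1 + S : PowerSeries ℚ) : LaurentSeries ℚ) := by
  obtain ⟨S, h0, hS⟩ := HookConfig.exists_sqrt_motzkin
  obtain ⟨t, ht, hSt⟩ := exists_motzkin_of_sq_eq h0 hS
  have hc := HookConfig.configSeries_zero_mul ht
  have ht1 : 1 - t ≠ 0 := right_ne_zero_of_mul_eq_one hc
  have hden : 3 * PowerSeries.X - 1 + S = 2 * PowerSeries.X * (1 - t) := by
    rw [hSt]; ring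
  have hne : 3 * PowerSeries.X - 1 + S ≠ 0 := by
    have h2 : (2 : PowerSeries ℚ) ≠ 0 := fun h => by
      simpa using (map_ofNat (PowerSeries.constantCoeff (R := ℚ)) 2).symm.trans (congrArg _ h)
    rw [hden]
    exact mul_ne_zero (mul_ne_zero h2 PowerSeries.X_ne_zero) ht1
  refine ⟨S, ⟨h0, hS⟩, hne, ?_⟩
  have hmk : (PowerSeries.mk fun n : ℕ => ((HookConfig.VHCs (HookConfig.Av n
      {⟨3, HookConfig.p231⟩, ⟨4, HookConfig.p1243⟩})).ncard : ℚ)) =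
      1 + PowerSeries.X * PowerSeries.mk fun n => (HookConfig.configCount n 0 : ℚ) := by
    ext (_ | n)
    · simp [HookConfig.ncard_VHCs_zero]
    · simp [HookConfig.ncard_VHCs_succ, PowerSeries.coeff_succ_X_mul, PowerSeries.coeff_one]
  have hne' : ((3 * PowerSeries.X - 1 + S : PowerSeries ℚ) : LaurentSeries ℚ) ≠ 0 := by
    rw [Ne, ← PowerSeries.coe_zero]
    exact fun h => hne (HahnSeries.ofPowerSeries_injective h)
  rw [hmk, ← sub_eq_iff_eq_add', eq_div_iff hne', ← PowerSeries.coe_one, ← PowerSeries.coe_sub,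
    ← PowerSeries.coe_mul, hden]
  refine congrArg _ ?_
  linear_combination 2 * PowerSeries.X ^ 2 * hc
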